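/- Let $P_0\subset\mathbb{R}^2$ be a convex polygon with nonempty interior, let $h\ge 1$, and let $P_1,\dots,P_h$ be pairwise disjoint convex polygons with nonempty interior contained in the interior of $P_0$. The closed domain $P=P_0\setminus\bigcup_{i=1}^h \operatorname{int}P_i$ is called a convex polygon with $h$ convex holes; $\mathcal C(h)$ is the family of all such $P$, and ${\rm diam}_2(P)=\sup_{x,y\in P}\|x-y\|$. For $s\in P$ and a unit vector $u$, a greedy path from $s$ in direction $u$ is a path produced by the following algorithm. Start from $s$ along the ray in direction $u$ until it reaches the boundary of $P$ at a point $p$. As long as $p\notin\partial P_0$, say $p\in\partial P_i$ with $i\geq 1$: follow $\partial P_i$, on the side facing $s$ and with monotonically increasing distance from $s$, to a point $t$ at which the ray from $s$ through $t$ is tangent to $P_i$; then continue from $t$ along this ray until it reaches the boundary of $P$ again, at a new point $p$. The path ends when $p\in\partial P_0$. (Where a ray only touches a hole, the path may pass straight on. Where several choices satisfy the conditions, each of them is allowed.) Then: 1. There is an absolute constant $C>0$ such that for every $h\ge 1$, every $P\in\mathcal C(h)$, every $s\in P$ and every unit vector $u$, a greedy path from $s$ in direction $u$ exists (the algorithm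 can be carried out and terminates), and every such greedy path has length at most $C\,h^{1/2}\,{\rm diam}_2(P)$. 2. This is best possible: there is an absolute constant $c>0$ such that for every $h\ge 1$ there are $P\in\mathcal C(h)$ and $s\in P$ such that for every unit vector $u$, every greedy path from $s$ in direction $u$ has length at least $c\,h^{1/2}\,{\rm diam}_2(P)$. -/

import Mathlib

/-- The Euclidean plane. -/
abbrev Plane : Type := EuclideanSpace ℝ (Fin 2)

/-- A (closed, solid, nondegenerate) convex polygon: the convex hull of finitely many points,
with nonempty interior. -/
def IsConvexPolygon (K : Set Plane) : Prop :=
  (∃ V : Finset Plane, K = convexHull ℝ (V : Set Plane)) ∧ (interior K).Nonempty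

/-- A convex polygon with `h` convex holes: the holes are pairwise disjoint convex polygons
in the interior of the convex outer polygon. -/
structure ConvexPolygonWithHoles (h : ℕ) where
  outer : Set Plane
  hole : Fin h → Set Plane
  outer_polygon : IsConvexPolygon outer
  hole_polygon : ∀ i, IsConvexPolygon (hole i)
  hole_subset : ∀ i, hole i ⊆ interior outer
  hole_disjoint : ∀ i j, i ≠ j → Disjoint (hole i) (hole j)

namespace ConvexPolygonWithHoles

/-- The polygonal domain itself. It is closed: the boundaries of the holes belong to it, so that
paths may run along them. -/
def carrier {h : ℕ} (P : ConvexPolygonWithHoles h) : Set Plane :=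
  P.outer \ ⋃ i, interior (P.hole i)

/-- The Euclidean diameter of the domain. -/
noncomputable def diam₂ {h : ℕ} (P : ConvexPolygonWithHoles h) : ℝ :=
  Metric.diam P.carrier

end ConvexPolygonWithHoles

/-- The length of the polygonal path that visits the listed points in this order. -/
noncomputable def pathLength : List Plane → ℝ
  | [] => 0
  | [_] => 0
  | a :: b :: l => dist a b + pathLength (b :: l)

/-- The planar cross product; it is positive if `b` points to the left of `a`. -/
def cross (a b : Plane) : ℝ := a 0 * b 1 - a 1 * b 0

/-- The ray from `s` through the point `q` of `K` is tangent to `K`, and `K` lies on the left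
side of it. -/
def IsLeftTangentPoint (s : Plane) (K : Set Plane) (q : Plane) : Prop :=
  q ∈ K ∧ q ≠ s ∧ ∀ x ∈ K, 0 ≤ cross (q - s) (x - s)

/-- The ray from `s` through the point `q` of `K` is tangent to `K`, and `K` lies on the right
side of it. -/
def IsRightTangentPoint (s : Plane) (K : Set Plane) (q : Plane) : Prop :=
  q ∈ K ∧ q ≠ s ∧ ∀ x ∈ K, cross (q - s) (x - s) ≤ 0

/-- The part of the boundary of `K` between the two points of tangency that faces `s`: the
boundary points that are not hidden from `s` by the interior of `K`. -/
def nearSide (s : Plane) (K : Set Plane) : Set Plane :=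
  {x | x ∈ frontier K ∧ Disjoint (openSegment ℝ s x) (interior K)}

/-- `IsBoundaryArc s K p q l`: the polygonal path with vertices `l` leads from `p` to `q`, runs in
the part of the boundary of `K` that faces `s`, and the distance from `s` increases
monotonically along it. The one-point path is allowed. -/
inductive IsBoundaryArc (s : Plane) (K : Set Plane) : Plane → Plane → List Plane → Prop
  | point (p : Plane) : IsBoundaryArc s K p p [p]
  | edge (a b q : Plane) (l : List Plane)
      (on_boundary : segment ℝ a b ⊆ nearSide s K)
      (increasing : StrictMonoOn (fun t : ℝ => dist s (AffineMap.lineMap a b t)) (Set.Icc 0 1))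
      (tail : IsBoundaryArc s K b q l) : IsBoundaryArc s K a q (a :: l)

/-- `ReachesAlongRay D p v q`: the ray from `p` in direction `v` reaches the point `q` inside the
domain `D`; here `q = p` counts only if the ray leaves `D` immediately. -/
def ReachesAlongRay (D : Set Plane) (p v q : Plane) : Prop :=
  ∃ t : ℝ, 0 ≤ t ∧ q = p + t • v ∧ segment ℝ p q ⊆ D ∧
    (t = 0 → ∀ ε : ℝ, 0 < ε → ∃ r : ℝ, 0 < r ∧ r < ε ∧ p + r • v ∉ D)

/-- `IsGreedyFrom P s p v l`: the polygonal path with vertices `l` is a run of the greedy algorithm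
with source `s` whose current point is `p` and which is about to move along the ray from `p` in
direction `v`. Where the ray reaches the outer boundary, the path ends. Where it reaches the
boundary of a hole, the path follows that boundary, with increasing distance from `s`, to one of
the two points of tangency from `s`, and goes on along the ray from `s` through that point. -/
inductive IsGreedyFrom {h : ℕ} (P : ConvexPolygonWithHoles h) (s : Plane) :
    Plane → Plane → List Plane → Prop
  | exit (p v q : Plane)
      (ray : ReachesAlongRay P.carrier p v q)
      (hit : q ∈ frontier P.outer) : IsGreedyFrom P s p v [p, q]
  | turn (p v q t : Plane) (i : Fin h) (arc rest : List Plane)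
      (ray : ReachesAlongRay P.carrier p v q)
      (hit : q ∈ frontier (P.hole i))
      (tangent : IsLeftTangentPoint s (P.hole i) t ∨ IsRightTangentPoint s (P.hole i) t)
      (along : IsBoundaryArc s (P.hole i) q t arc)
      (next : IsGreedyFrom P s t (t - s) rest) : IsGreedyFrom P s p v (p :: (arc ++ rest))

/-- The polygonal path `l` is a greedy path from `s` in direction `u` to the outer boundary. -/
def IsGreedyPath {h : ℕ} (P : ConvexPolygonWithHoles h) (s u : Plane) (l : List Plane) : Prop :=
  IsGreedyFrom P s s u l

/-! Upper bound. Along rays from `s` the path only gains distance from `s`, so the radial parts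
together have length at most the diameter `R`. An arc along a hole is either radial too, or it turns
around `s` in one orientation. In the second case convexity gives two facts: the arc is at most
twice as long as its chord, and the square of the chord is at most the gain in squared distance from
`s` (`IsBoundaryArc.radial_or_strict`). The squares of all chords therefore sum to at most `R ^ 2`.
Each hole carries at most one such arc per orientation: the arc ends at the extreme tangent point,
and every outward edge with that orientation starts closer to `s` than this point
(`StrictEdge.norm_lt_of_tangent`). So there are at most `2 * h` chords (`exists_chords`), and
Cauchy–Schwarz bounds their sum by `√(2h) R`.

Existence. Where a ray enters a hole, at least one of the two boundary directions does not approach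
`s`. Following it from vertex to vertex, the distance keeps growing until a tangent point is reached
(`exists_arc`). Each turn ends at a vertex strictly farther from `s`, so finitely many turns
suffice.

Lower bound. Triangles are placed in consecutive annuli around the origin so that leaving one at its
right end forces the path to hit the next one and to leave that at its right end as well
(`IsTriangleChain`). Five triangles surround the origin and catch every direction; the others zigzag
across the first axis at distance of order `h`, with amplitude of order `√h`. At that distance the
squared distance grows by order `h` per unit step, just what a crossing of height `√h` requires.
About `h` crossings of length at least `√h` in a domain of diameter of order `h` give the bound. -/

namespace GreedyPath

open Filter Topology

/-! ### Dot and cross products, half-planes and triangles -/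

/-- The dot product of the plane, in coordinates. -/
def dot (a b : Plane) : ℝ := a 0 * b 0 + a 1 * b 1

theorem norm_sq_eq (a : Plane) : ‖a‖ ^ 2 = a 0 ^ 2 + a 1 ^ 2 := by
  rw [EuclideanSpace.real_norm_sq_eq, Fin.sum_univ_two]

theorem norm_sq_eq_dot (a : Plane) : ‖a‖ ^ 2 = dot a a := by
  rw [norm_sq_eq, dot]; ring

theorem plane_ext {a b : Plane} (h0 : a 0 = b 0) (h1 : a 1 = b 1) : a = b := by
  ext i; fin_cases i <;> assumption

theorem dot_sq_add_cross_sq (a b : Plane) : dot a b ^ 2 + cross a b ^ 2 = ‖a‖ ^ 2 * ‖b‖ ^ 2 := by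
  rw [norm_sq_eq, norm_sq_eq, dot, cross]; ring

theorem abs_dot_le (a b : Plane) : |dot a b| ≤ ‖a‖ * ‖b‖ := by
  apply abs_le_of_sq_le_sq _ (by positivity)
  nlinarith [dot_sq_add_cross_sq a b, sq_nonneg (cross a b)]

theorem abs_cross_le (a b : Plane) : |cross a b| ≤ ‖a‖ * ‖b‖ := by
  apply abs_le_of_sq_le_sq _ (by positivity)
  nlinarith [dot_sq_add_cross_sq a b, sq_nonneg (dot a b)]

theorem norm_mul_norm_le (a b : Plane) : ‖a‖ * ‖b‖ ≤ |dot a b| + |cross a b| := by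
  apply le_of_sq_le_sq _ (by positivity)
  nlinarith [dot_sq_add_cross_sq a b, sq_abs (dot a b), sq_abs (cross a b),
    mul_nonneg (abs_nonneg (dot a b)) (abs_nonneg (cross a b))]

/-- Two vectors in the plane in the basis consisting of a third one and its rotated copy. -/
theorem dot_self_mul_cross (b x y : Plane) :
    dot b b * cross x y = dot b x * cross b y - cross b x * dot b y := by
  simp only [dot, cross]; ring

theorem dot_self_pos {a : Plane} (h : a ≠ 0) : 0 < dot a a := by
  rw [← norm_sq_eq_dot]
  have := norm_pos_iff.2 h
  positivity

theorem norm_le_norm_iff_dot (a b : Plane) : ‖a‖ ≤ ‖b‖ ↔ dot a a ≤ dot b b := by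
  rw [← norm_sq_eq_dot, ← norm_sq_eq_dot, sq_le_sq₀ (norm_nonneg _) (norm_nonneg _)]

theorem norm_lt_norm_iff_dot (a b : Plane) : ‖a‖ < ‖b‖ ↔ dot a a < dot b b := by
  rw [← norm_sq_eq_dot, ← norm_sq_eq_dot, sq_lt_sq₀ (norm_nonneg _) (norm_nonneg _)]

theorem continuous_cross {X : Type*} [TopologicalSpace X] {f g : X → Plane}
    (hf : Continuous f) (hg : Continuous g) : Continuous fun x => cross (f x) (g x) := by
  unfold cross
  fun_prop

theorem convex_halfPlane (σ : ℝ) (w a : Plane) : Convex ℝ {x : Plane | σ * cross w (x - a) ≤ 0} := by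
  intro x hx y hy α β hα hβ hαβ
  simp only [Set.mem_ofPred_eq, cross, PiLp.sub_apply, PiLp.add_apply, PiLp.smul_apply,
    smul_eq_mul] at *
  have h := add_nonpos (mul_nonpos_of_nonneg_of_nonpos hα hx) (mul_nonpos_of_nonneg_of_nonpos hβ hy)
  have : α = 1 - β := by linarith
  subst this
  linarith

theorem convexHull_subset_halfPlane {S : Set Plane} {σ : ℝ} {w a : Plane}
    (h : ∀ x ∈ S, σ * cross w (x - a) ≤ 0) : ∀ x ∈ convexHull ℝ S, σ * cross w (x - a) ≤ 0 :=
  fun _ hx => convexHull_min h (convex_halfPlane σ w a) hx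

theorem exists_smul_add_mem_of_mem_interior {K : Set Plane} {x : Plane} (hx : x ∈ interior K)
    (n : Plane) : ∃ ε : ℝ, 0 < ε ∧ x + ε • n ∈ K := by
  have hc : Filter.Tendsto (fun ε : ℝ => x + ε • n) (nhdsWithin 0 (Set.Ioi 0)) (nhds x) := by
    have : Continuous fun ε : ℝ => x + ε • n := by fun_prop
    simpa using (this.tendsto 0).mono_left nhdsWithin_le_nhds
  have h := hc.eventually (mem_interior_iff_mem_nhds.1 hx)
  obtain ⟨ε, hε, hε0⟩ := (h.and self_mem_nhdsWithin).exists
  exact ⟨ε, hε0, hε⟩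

/-- From an interior point one can move a little along the outward normal and stay in `K`; this
would violate an inequality that was already tight. -/
theorem cross_neg_of_mem_interior {K : Set Plane} {σ : ℝ} {w a x : Plane} (hσ : σ ≠ 0)
    (hw : w ≠ 0) (hK : ∀ y ∈ K, σ * cross w (y - a) ≤ 0) (hx : x ∈ interior K) :
    σ * cross w (x - a) < 0 := by
  obtain ⟨ε, hε, hm⟩ := exists_smul_add_mem_of_mem_interior hx (σ • !₂[-w 1, w 0])
  have h := hK _ hm
  have hd := dot_self_pos hw
  have : σ * cross w (x + ε • (σ • !₂[-w 1, w 0]) - a)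
      = σ * cross w (x - a) + ε * σ ^ 2 * dot w w := by
    simp [cross, dot]; ring
  rw [this] at h
  have : 0 < ε * σ ^ 2 * dot w w := by positivity
  linarith

theorem combo_mem_convexHull (a b c : Plane) {α β γ : ℝ} (hα : 0 ≤ α) (hβ : 0 ≤ β) (hγ : 0 ≤ γ)
    (hs : α + β + γ = 1) : α • a + β • b + γ • c ∈ convexHull ℝ {a, b, c} := by
  have h := (convex_convexHull ℝ ({a, b, c} : Set Plane)).sum_mem (t := Finset.univ)
    (w := ![α, β, γ]) (z := ![a, b, c])
    (by intro i _; fin_cases i <;> simpa) (by simpa [Fin.sum_univ_three] using hs)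
    (by intro i _; apply subset_convexHull; fin_cases i <;> simp)
  simpa [Fin.sum_univ_three] using h

theorem exists_combo_of_mem_convexHull {a b c x : Plane} (hx : x ∈ convexHull ℝ {a, b, c}) :
    ∃ α β γ : ℝ, 0 ≤ α ∧ 0 ≤ β ∧ 0 ≤ γ ∧ α + β + γ = 1 ∧ x = α • a + β • b + γ • c := by
  rw [convexHull_insert (by simp), convexHull_pair] at hx
  simp only [convexJoin_singleton_left, Set.mem_iUnion, exists_prop] at hx
  obtain ⟨y, ⟨β, γ, hβ, hγ, hs, rfl⟩, ⟨α, δ, hα, hδ, hs', rfl⟩⟩ := hx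
  refine ⟨α, δ * β, δ * γ, hα, by positivity, by positivity, ?_, ?_⟩
  · rw [add_assoc, ← mul_add, hs]; linarith
  · rw [smul_add, smul_smul, smul_smul, add_assoc]

/-- Barycentric coordinates are quotients of cross products, hence continuous, so their positivity
is an open condition. -/
theorem combo_mem_interior {a b c : Plane} (h : cross (b - a) (c - a) ≠ 0) {α β γ : ℝ}
    (hα : 0 < α) (hβ : 0 < β) (hγ : 0 < γ) (hs : α + β + γ = 1) :
    α • a + β • b + γ • c ∈ interior (convexHull ℝ {a, b, c}) := by
  set D := cross (b - a) (c - a) with hD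
  let U : Set Plane := {x | 0 < cross (b - x) (c - x) / D} ∩ {x | 0 < cross (c - x) (a - x) / D} ∩
    {x | 0 < cross (a - x) (b - x) / D}
  have hU : IsOpen U := by
    refine ((isOpen_lt continuous_const ?_).inter (isOpen_lt continuous_const ?_)).inter
      (isOpen_lt continuous_const ?_) <;>
    exact (continuous_cross (by fun_prop) (by fun_prop)).div_const _
  have hsub : U ⊆ convexHull ℝ {a, b, c} := by
    rintro x ⟨⟨h1, h2⟩, h3⟩
    have : x = (cross (b - x) (c - x) / D) • a + (cross (c - x) (a - x) / D) • b +
        (cross (a - x) (b - x) / D) • c := by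
      apply plane_ext <;>
      · simp only [PiLp.add_apply, PiLp.smul_apply, smul_eq_mul]
        field_simp
        simp only [hD, cross, PiLp.sub_apply]
        ring
    rw [this]
    apply combo_mem_convexHull _ _ _ h1.le h2.le h3.le
    field_simp
    simp only [hD, cross, PiLp.sub_apply]
    ring
  apply interior_maximal hsub hU
  have hα' : α = 1 - β - γ := by linarith
  refine ⟨⟨?_, ?_⟩, ?_⟩ <;> rw [Set.mem_ofPred_eq]
  · convert hα using 1
    rw [div_eq_iff h]
    simp only [hD, hα', cross, PiLp.sub_apply, PiLp.add_apply, PiLp.smul_apply, smul_eq_mul]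
    ring
  · convert hβ using 1
    rw [div_eq_iff h]
    simp only [hD, hα', cross, PiLp.sub_apply, PiLp.add_apply, PiLp.smul_apply, smul_eq_mul]
    ring
  · convert hγ using 1
    rw [div_eq_iff h]
    simp only [hD, hα', cross, PiLp.sub_apply, PiLp.add_apply, PiLp.smul_apply, smul_eq_mul]
    ring

/-! ### Outward edges and arcs facing the source -/

/-- The edge from `a` to `b` is a part of the boundary of `K` facing `s` that is traversed
counterclockwise around `s` (for `σ = 1`, clockwise for `σ = -1`), away from `s`. -/
structure StrictEdge (σ : ℝ) (s : Plane) (K : Set Plane) (a b : Plane) : Prop where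
  left_mem : a ∈ K
  right_mem : b ∈ K
  turn : 0 < σ * cross (a - s) (b - s)
  out : 0 ≤ dot (a - s) (b - a)
  side : ∀ x ∈ K, σ * cross (b - a) (x - a) ≤ 0

/-- If a point `x` of `K` were on the same side of the edge as `s`, the triangle `a b x` would
contain, next to the midpoint of the edge, interior points on the way from `s`, and the midpoint
would be hidden. -/
theorem side_of_segment_subset_nearSide {σ : ℝ} {s a b : Plane} {K : Set Plane} (hK : Convex ℝ K)
    (hcl : IsClosed K) (hab : segment ℝ a b ⊆ nearSide s K)
    (hturn : 0 < σ * cross (a - s) (b - s)) :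
    ∀ x ∈ K, σ * cross (b - a) (x - a) ≤ 0 := by
  intro x hx
  by_contra! hpos
  have ha : a ∈ K := hcl.frontier_subset (hab (left_mem_segment ℝ a b)).1
  have hb : b ∈ K := hcl.frontier_subset (hab (right_mem_segment ℝ a b)).1
  set D := cross (b - a) (x - a) with hD
  have hD0 : D ≠ 0 := by rintro h; simp [h] at hpos
  have hσ : σ ≠ 0 := by rintro rfl; simp at hpos
  set α := cross (b - s) (x - s) / D with hα
  set β := cross (x - s) (a - s) / D with hβ
  set γ := cross (a - s) (b - s) / D with hγ
  have hγ0 : 0 < γ := by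
    rw [hγ, ← mul_div_mul_left _ _ hσ]; positivity
  have hsum : α + β + γ = 1 := by
    rw [hα, hβ, hγ]; field_simp
    simp only [hD, cross, PiLp.sub_apply]; ring
  have hs : s = α • a + β • b + γ • x := by
    apply plane_ext <;>
    · simp only [PiLp.add_apply, PiLp.smul_apply, smul_eq_mul, hα, hβ, hγ]
      field_simp
      simp only [hD, cross, PiLp.sub_apply]
      ring
  clear_value α β γ
  -- The point at fraction `M⁻¹` of the way from the midpoint to `s` must have positive barycentric
  -- coordinates; `α` and `β` may be negative, so `M` has to dominate them.
  set M := 2 + 2 * |α| + 2 * |β| with hM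
  have hM0 : 0 < M := by positivity
  have hM1 : 1 < M := by have := abs_nonneg α; have := abs_nonneg β; linarith
  have h1 : 0 < (1 - M⁻¹) / 2 + M⁻¹ * α := by
    have : (1 - M⁻¹) / 2 + M⁻¹ * α = (M - 1 + 2 * α) / (2 * M) := by field_simp
    rw [this]
    have := neg_abs_le α; have := abs_nonneg β
    apply div_pos <;> linarith
  have h2 : 0 < (1 - M⁻¹) / 2 + M⁻¹ * β := by
    have : (1 - M⁻¹) / 2 + M⁻¹ * β = (M - 1 + 2 * β) / (2 * M) := by field_simp
    rw [this]
    have := neg_abs_le β; have := abs_nonneg α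
    apply div_pos <;> linarith
  have hint := combo_mem_interior (a := a) (b := b) (c := x) hD0 h1 h2
    (mul_pos (inv_pos.2 hM0) hγ0) (by linear_combination M⁻¹ * hsum)
  have hsub : convexHull ℝ {a, b, x} ⊆ K :=
    convexHull_min (by rintro y (rfl | rfl | rfl) <;> assumption) hK
  have hmid : (1 / 2 : ℝ) • a + (1 / 2 : ℝ) • b ∈ segment ℝ a b :=
    ⟨1 / 2, 1 / 2, by norm_num, by norm_num, by norm_num, rfl⟩
  refine Set.disjoint_left.1 (hab hmid).2 ?_ (interior_mono hsub hint)
  refine ⟨M⁻¹, 1 - M⁻¹, inv_pos.2 hM0, sub_pos.2 (inv_lt_one_of_one_lt₀ hM1), by ring, ?_⟩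
  rw [hs]
  module

theorem dist_sq_lineMap (s a b : Plane) (t : ℝ) : dist s (AffineMap.lineMap a b t) ^ 2 =
    dot (a - s) (a - s) + 2 * t * dot (a - s) (b - a) + t ^ 2 * dot (b - a) (b - a) := by
  rw [dist_comm, dist_eq_norm, norm_sq_eq]
  simp only [AffineMap.lineMap_apply, vsub_eq_sub, vadd_eq_add, PiLp.sub_apply, PiLp.add_apply,
    PiLp.smul_apply, smul_eq_mul, dot]
  ring

theorem dot_nonneg_of_strictMonoOn {s a b : Plane}
    (h : StrictMonoOn (fun t : ℝ => dist s (AffineMap.lineMap a b t)) (Set.Icc 0 1)) :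
    0 ≤ dot (a - s) (b - a) := by
  by_contra! hd
  have hw : b - a ≠ 0 := by intro h0; simp [h0, dot] at hd
  have hW := dot_self_pos hw
  set d := dot (a - s) (b - a)
  set W := dot (b - a) (b - a)
  have ht0 : 0 < min 1 (-d / W) := lt_min one_pos (div_pos (by linarith) hW)
  have hlt := h (Set.left_mem_Icc.2 zero_le_one) ⟨ht0.le, min_le_left _ _⟩ ht0
  have hsq := pow_lt_pow_left₀ hlt dist_nonneg two_ne_zero
  rw [dist_sq_lineMap, dist_sq_lineMap] at hsq
  have hle : min 1 (-d / W) * W ≤ -d := by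
    have := min_le_right 1 (-d / W)
    rwa [le_div_iff₀ hW] at this
  have := mul_le_mul_of_nonneg_left hle ht0.le
  have := mul_neg_of_pos_of_neg ht0 hd
  change _ < _ + 2 * _ * d + _ ^ 2 * W at hsq
  nlinarith

theorem norm_lt_of_strictMonoOn {s a b : Plane}
    (h : StrictMonoOn (fun t : ℝ => dist s (AffineMap.lineMap a b t)) (Set.Icc 0 1)) :
    ‖a - s‖ < ‖b - s‖ := by
  have := h (Set.left_mem_Icc.2 zero_le_one) (Set.right_mem_Icc.2 zero_le_one) one_pos
  simpa [dist_comm s, dist_eq_norm] using this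

theorem exists_smul_eq_of_cross_eq_zero {A B : Plane} (h : cross A B = 0) (hAB : ‖A‖ < ‖B‖)
    (hd : 0 ≤ dot A (B - A)) : ∃ κ : ℝ, 0 ≤ κ ∧ κ < 1 ∧ A = κ • B := by
  have hB : B ≠ 0 := norm_pos_iff.1 ((norm_nonneg A).trans_lt hAB)
  have hBB := dot_self_pos hB
  have h1 : 0 ≤ dot A B := by
    have : dot A B = dot A (B - A) + dot A A := by
      simp only [dot, PiLp.sub_apply]; ring
    rw [this, ← norm_sq_eq_dot]; positivity
  have h2 : dot A B < dot B B := by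
    rw [← norm_sq_eq_dot]
    calc dot A B ≤ ‖A‖ * ‖B‖ := (le_abs_self _).trans (abs_dot_le A B)
      _ < ‖B‖ ^ 2 := by rw [sq]; exact mul_lt_mul_of_pos_right hAB (norm_pos_iff.2 hB)
  refine ⟨dot A B / dot B B, by positivity, by rwa [div_lt_one hBB], ?_⟩
  have h0 : A 0 * B 1 - A 1 * B 0 = 0 := h
  apply plane_ext <;> simp only [PiLp.smul_apply, smul_eq_mul] <;> field_simp <;>
    simp only [dot]
  · linear_combination B 1 * h0
  · linear_combination -B 0 * h0

theorem edge_radial_or_strict {σ : ℝ} (hσ : σ ^ 2 = 1) {s a b : Plane} {K : Set Plane}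
    (hK : Convex ℝ K) (hcl : IsClosed K) (hab : segment ℝ a b ⊆ nearSide s K)
    (h : StrictMonoOn (fun t : ℝ => dist s (AffineMap.lineMap a b t)) (Set.Icc 0 1)) :
    (∃ κ : ℝ, 0 ≤ κ ∧ κ < 1 ∧ a - s = κ • (b - s)) ∨ StrictEdge σ s K a b ∨
      StrictEdge (-σ) s K a b := by
  have ha : a ∈ K := hcl.frontier_subset (hab (left_mem_segment ℝ a b)).1
  have hb : b ∈ K := hcl.frontier_subset (hab (right_mem_segment ℝ a b)).1
  have hd := dot_nonneg_of_strictMonoOn h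
  rcases lt_trichotomy (σ * cross (a - s) (b - s)) 0 with hc | hc | hc
  · have hc' : 0 < -σ * cross (a - s) (b - s) := by linarith
    exact .inr (.inr ⟨ha, hb, hc', hd, side_of_segment_subset_nearSide hK hcl hab hc'⟩)
  · refine .inl (exists_smul_eq_of_cross_eq_zero ?_ (norm_lt_of_strictMonoOn h) ?_)
    · have : σ ≠ 0 := by rintro rfl; simp at hσ
      simpa [this] using hc
    · simpa using hd
  · exact .inr (.inl ⟨ha, hb, hc, hd, side_of_segment_subset_nearSide hK hcl hab hc⟩)

theorem StrictEdge.left_ne {σ : ℝ} {s a b : Plane} {K : Set Plane} (h : StrictEdge σ s K a b) :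
    a - s ≠ 0 := by
  intro h0
  have := h.turn
  simp [h0, cross] at this

theorem StrictEdge.right_ne {σ : ℝ} {s a b : Plane} {K : Set Plane} (h : StrictEdge σ s K a b) :
    b - s ≠ 0 := by
  intro h0
  have := h.turn
  simp [h0, cross] at this

/-- The line of a strict edge separates `s` from `K`, but `a` would lie on the side of `s`. -/
theorem StrictEdge.not_radial {σ : ℝ} {s a b c : Plane} {K : Set Plane}
    (h : StrictEdge σ s K b c) (ha : a ∈ K) {κ : ℝ} (hκ : κ < 1) (hab : a - s = κ • (b - s)) :
    False := by
  have h1 := h.side a ha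
  have h2 := h.turn
  have e : a - b = (κ - 1) • (b - s) := by
    rw [sub_smul, ← hab]; simp
  have : cross (c - b) (a - b) = (1 - κ) * cross (b - s) (c - s) := by
    rw [e]; simp only [cross, PiLp.sub_apply, PiLp.smul_apply, smul_eq_mul]; ring
  rw [this] at h1
  nlinarith [mul_pos (sub_pos.2 hκ) h2]

/-- Both edges would lie on the same angular side of `b`, with `a` falling back towards `s` and `c`
not; then `a` would be on the same side of the line `b c` as `s`, against `side`. -/
theorem StrictEdge.not_reverse {σ : ℝ} {s a b c : Plane} {K : Set Plane}
    (h : StrictEdge σ s K a b) (h' : StrictEdge (-σ) s K b c) : False := by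
  have h1 := h'.side a h.left_mem
  have h2 := h.turn
  have h3 := h'.turn
  have hB := dot_self_pos h.right_ne
  have id := dot_self_mul_cross (b - s) (c - b) (a - b)
  have e1 : cross (b - s) (a - b) = - cross (a - s) (b - s) := by
    simp only [cross, PiLp.sub_apply]; ring
  have e2 : cross (b - s) (c - b) = cross (b - s) (c - s) := by
    simp only [cross, PiLp.sub_apply]; ring
  have hw : b - a ≠ 0 := by
    intro h0
    rw [sub_eq_zero] at h0
    subst h0
    simp [cross, mul_comm] at h2
  have e3 : dot (b - s) (a - b) < 0 := by
    have : dot (b - s) (a - b) = -dot (a - s) (b - a) - dot (b - a) (b - a) := by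
      simp only [dot, PiLp.sub_apply]; ring
    rw [this]
    linarith [h.out, dot_self_pos hw]
  rw [e1, e2] at id
  have p1 := mul_nonneg h'.out h2.le
  have p2 := mul_pos h3 (neg_pos.2 e3)
  have p3 := mul_nonneg hB.le (neg_nonneg.2 h1)
  replace id := congrArg (σ * ·) id
  linarith

theorem StrictEdge.turn_trans {σ : ℝ} {s a b q : Plane} {K : Set Plane}
    (h : StrictEdge σ s K a b) (hq : q ∈ K) (hbq : 0 ≤ σ * cross (b - s) (q - s)) :
    0 < σ * cross (a - s) (q - s) := by
  have h1 := h.side q hq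
  have h2 := h.turn
  have : cross (b - a) (q - a) =
      cross (b - s) (q - s) + cross (a - s) (b - s) - cross (a - s) (q - s) := by
    simp only [cross, PiLp.sub_apply]; ring
  rw [this] at h1
  linarith

/-- Since `q` is beyond the edge and turned in its orientation, the direction `q - a` lies between
those of `a - s` and `b - a`, neither of which points towards `s`. This is what makes the squared
chord at most the gain in squared distance. -/
theorem StrictEdge.dot_nonneg {σ : ℝ} {s a b q : Plane} {K : Set Plane}
    (h : StrictEdge σ s K a b) (hq : q ∈ K) (haq : 0 ≤ σ * cross (a - s) (q - s)) :
    0 ≤ dot (a - s) (q - a) := by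
  have h1 := h.side q hq
  have h2 := h.turn
  have id := dot_self_mul_cross (a - s) (b - a) (q - a)
  have e1 : cross (a - s) (b - a) = cross (a - s) (b - s) := by
    simp only [cross, PiLp.sub_apply]; ring
  have e2 : cross (a - s) (q - a) = cross (a - s) (q - s) := by
    simp only [cross, PiLp.sub_apply]; ring
  rw [e1, e2] at id
  have p1 := mul_nonneg h.out haq
  have p2 := mul_nonneg (dot_self_pos h.left_ne).le (neg_nonneg.2 h1)
  replace id := congrArg (σ * ·) id
  have : 0 ≤ (σ * cross (a - s) (b - s)) * dot (a - s) (q - a) := by linarith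
  exact nonneg_of_mul_nonneg_right this h2

/-- Seen from the fixed direction `q - s` to the end of the arc, every edge has a nonnegative radial
and a nonnegative transversal component. The right-hand side is linear in the edge, so these bounds
can be summed along an arc. -/
theorem StrictEdge.norm_mul_norm_le {σ : ℝ} (hσ : σ ^ 2 = 1) {s a b q : Plane} {K : Set Plane}
    (h : StrictEdge σ s K a b) (hq : q ∈ K) (haq : 0 ≤ σ * cross (a - s) (q - s)) :
    ‖q - s‖ * dist a b ≤ dot (q - s) (b - a) + σ * cross (q - s) (b - a) := by
  have h1 := h.side q hq
  have h2 := h.turn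
  have hA := dot_self_pos h.left_ne
  have hd := h.dot_nonneg hq haq
  have c0 : 0 ≤ σ * cross (q - s) (b - a) := by
    have : cross (q - s) (b - a) = - cross (b - a) (q - a) + cross (a - s) (b - s) := by
      simp only [cross, PiLp.sub_apply]; ring
    rw [this]; linarith
  have d0 : 0 ≤ dot (q - s) (b - a) := by
    have id : dot (a - s) (a - s) * dot (q - s) (b - a) =
        (dot (a - s) (q - a) + dot (a - s) (a - s)) * dot (a - s) (b - a) +
          (σ * cross (a - s) (q - s)) * (σ * cross (a - s) (b - s)) := by
      have : (σ * cross (a - s) (q - s)) * (σ * cross (a - s) (b - s)) =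
          cross (a - s) (q - s) * cross (a - s) (b - s) := by
        linear_combination cross (a - s) (q - s) * cross (a - s) (b - s) * hσ
      rw [this]
      simp only [cross, dot, PiLp.sub_apply]; ring
    have : 0 ≤ dot (a - s) (a - s) * dot (q - s) (b - a) := by
      rw [id]
      exact add_nonneg (mul_nonneg (by linarith) h.out) (mul_nonneg haq h2.le)
    exact nonneg_of_mul_nonneg_right this hA
  have := GreedyPath.norm_mul_norm_le (q - s) (b - a)
  rw [dist_comm, dist_eq_norm]
  have hσa : |σ| = 1 := by rwa [← sq_eq_sq₀ (abs_nonneg _) zero_le_one, sq_abs, one_pow]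
  rw [← one_mul |cross (q - s) (b - a)|, ← hσa, ← abs_mul, abs_of_nonneg d0, abs_of_nonneg c0] at this
  exact this

theorem _root_.IsBoundaryArc.end_mem {s p q : Plane} {K : Set Plane} (hcl : IsClosed K) {l : List Plane}
    (h : IsBoundaryArc s K p q l) (hp : p ∈ K) : q ∈ K := by
  induction h with
  | point p => exact hp
  | edge a b q l hab _ _ ih => exact ih (hcl.frontier_subset (hab (right_mem_segment ℝ a b)).1)

theorem _root_.IsBoundaryArc.pathLength_cons {s p q : Plane} {K : Set Plane} {l : List Plane}
    (h : IsBoundaryArc s K p q l) (x : Plane) (m : List Plane) :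
    pathLength (x :: (l ++ m)) = dist x p + pathLength (l ++ m) := by
  cases h <;> rfl

theorem _root_.IsBoundaryArc.pathLength_append {s p q : Plane} {K : Set Plane} {l : List Plane}
    (h : IsBoundaryArc s K p q l) {m : List Plane} (hm : m.head? = some q) :
    pathLength (l ++ m) = pathLength l + pathLength m := by
  induction h with
  | point p =>
    cases m with
    | nil => simp at hm
    | cons y m =>
      obtain rfl : y = p := by simpa using hm
      simp [pathLength]
  | edge a b q l _ _ htail ih =>
    have h1 := htail.pathLength_cons a m
    have h2 := htail.pathLength_cons a []
    simp only [List.append_nil] at h2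
    rw [List.cons_append, h1, h2, ih hm, add_assoc]

theorem _root_.IsBoundaryArc.norm_le {s p q : Plane} {K : Set Plane} {l : List Plane}
    (h : IsBoundaryArc s K p q l) : ‖p - s‖ ≤ ‖q - s‖ := by
  induction h with
  | point p => exact le_rfl
  | edge a b q l _ hinc _ ih => exact (norm_lt_of_strictMonoOn hinc).le.trans ih

theorem _root_.IsBoundaryArc.dist_le_pathLength {s p q : Plane} {K : Set Plane} {l : List Plane}
    (h : IsBoundaryArc s K p q l) : dist p q ≤ pathLength l := by
  induction h with
  | point p => simp [pathLength]
  | edge a b q l _ _ htail ih =>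
    have h2 := htail.pathLength_cons a []
    simp only [List.append_nil] at h2
    rw [h2]
    exact (dist_triangle a b q).trans (by linarith)

/-- The point `a` of `K` behind `b` forbids a strict edge at `b`. A radial edge leaves such a point
behind its own end, so the arc stays on one line through `s`. -/
theorem _root_.IsBoundaryArc.of_radial {s b q : Plane} {K : Set Plane} (hK : Convex ℝ K)
    (hcl : IsClosed K) {l : List Plane} (h : IsBoundaryArc s K b q l) :
    ∀ a ∈ K, ∀ κ : ℝ, κ < 1 → a - s = κ • (b - s) → b ≠ s →
      (∃ μ : ℝ, q - s = μ • (b - s)) ∧ pathLength l = ‖q - s‖ - ‖b - s‖ := by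
  induction h with
  | point p => intro a _ κ _ _ _; exact ⟨⟨1, by simp⟩, by simp [pathLength]⟩
  | edge b c q l hbc hinc htail ih =>
    intro a ha κ hκ hab hb
    rcases edge_radial_or_strict (σ := 1) (by norm_num) hK hcl hbc hinc with
      ⟨ν, hν0, hν1, hν⟩ | hs | hs
    · have hbK : b ∈ K := hcl.frontier_subset (hbc (left_mem_segment ℝ b c)).1
      have hlt := norm_lt_of_strictMonoOn hinc
      have hc : c ≠ s := by
        rintro rfl
        rw [sub_self, norm_zero] at hlt
        exact (norm_nonneg _).not_gt hlt
      obtain ⟨⟨μ, hμ⟩, hlen⟩ := ih b hbK ν hν1 hν hc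
      have hν0' : ν ≠ 0 := by
        rintro rfl
        rw [zero_smul, sub_eq_zero] at hν
        exact hb hν
      refine ⟨⟨μ * ν⁻¹, ?_⟩, ?_⟩
      · rw [hν, smul_smul, hμ, mul_assoc, inv_mul_cancel₀ hν0', mul_one]
      · have h2 := htail.pathLength_cons b []
        simp only [List.append_nil] at h2
        rw [h2, hlen, dist_comm, dist_eq_norm]
        have : c - b = (1 - ν) • (c - s) := by rw [sub_smul, ← hν]; simp
        rw [this, norm_smul, Real.norm_of_nonneg (by linarith), hν, norm_smul,
          Real.norm_of_nonneg hν0]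
        ring
    · exact (hs.not_radial ha hκ hab).elim
    · exact (hs.not_radial ha hκ hab).elim

/-- The preceding strict edge rules out a reversal. Hence the arc goes on with strict edges of the
same orientation, possibly followed by a radial tail, and the bounds for single edges telescope. -/
theorem _root_.IsBoundaryArc.of_strict {σ : ℝ} (hσ : σ ^ 2 = 1) {s b q : Plane} {K : Set Plane}
    (hK : Convex ℝ K) (hcl : IsClosed K) {l : List Plane} (h : IsBoundaryArc s K b q l) :
    ∀ a, StrictEdge σ s K a b → 0 ≤ σ * cross (b - s) (q - s) ∧
      ‖q - s‖ * pathLength l ≤ dot (q - s) (q - b) + σ * cross (q - s) (q - b) := by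
  induction h with
  | point p => intro a _; simp [pathLength, cross, dot, mul_comm]
  | edge b c q l hbc hinc htail ih =>
    intro a ha
    have h2 := htail.pathLength_cons b []
    simp only [List.append_nil] at h2
    rcases edge_radial_or_strict hσ hK hcl hbc hinc with ⟨ν, hν0, hν1, hν⟩ | hs | hs
    · have hb : b ≠ s := sub_ne_zero.1 ha.right_ne
      have hlt := norm_lt_of_strictMonoOn hinc
      have hc : c ≠ s := by
        rintro rfl
        rw [sub_self, norm_zero] at hlt
        exact (norm_nonneg _).not_gt hlt
      obtain ⟨⟨μ, hμ⟩, hlen⟩ := htail.of_radial hK hcl b ha.right_mem ν hν1 hν hc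
      have hcross : cross (b - s) (q - s) = 0 := by
        rw [hν, hμ]; simp only [cross, PiLp.smul_apply, smul_eq_mul]; ring
      have hdc : dist b c = ‖c - s‖ - ‖b - s‖ := by
        rw [dist_comm, dist_eq_norm]
        have : c - b = (1 - ν) • (c - s) := by rw [sub_smul, ← hν]; simp
        rw [this, norm_smul, Real.norm_of_nonneg (by linarith), hν, norm_smul,
          Real.norm_of_nonneg hν0]
        ring
      have e1 : cross (q - s) (q - b) = 0 := by
        have : cross (q - s) (q - b) = cross (b - s) (q - s) := by
          simp only [cross, PiLp.sub_apply]; ring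
        rw [this, hcross]
      have e2 : dot (q - s) (q - b) = ‖q - s‖ ^ 2 - dot (q - s) (b - s) := by
        rw [norm_sq_eq]; simp only [dot, PiLp.sub_apply]; ring
      have e3 := abs_dot_le (q - s) (b - s)
      have e4 := le_abs_self (dot (q - s) (b - s))
      rw [hcross, h2, hlen, hdc, e1, e2]
      exact ⟨by simp, by nlinarith⟩
    · obtain ⟨i1, i2⟩ := ih b hs
      have hq : q ∈ K := IsBoundaryArc.end_mem hcl htail hs.right_mem
      have hbq := hs.turn_trans hq i1
      refine ⟨hbq.le, ?_⟩
      have h3 := hs.norm_mul_norm_le hσ hq hbq.le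
      have e1 : dot (q - s) (q - b) = dot (q - s) (c - b) + dot (q - s) (q - c) := by
        simp only [dot, PiLp.sub_apply]; ring
      have e2 : cross (q - s) (q - b) = cross (q - s) (c - b) + cross (q - s) (q - c) := by
        simp only [cross, PiLp.sub_apply]; ring
      rw [h2, e1, e2, mul_add]
      linarith
    · exact (ha.not_reverse hs).elim

/-- An arc facing `s` and leading away from `s` is either radial, or of a length comparable to the
distance of its ends, which in turn is controlled by the gain in the squared distance from `s`. -/
theorem _root_.IsBoundaryArc.radial_or_strict {s p q : Plane} {K : Set Plane}
    (hK : Convex ℝ K) (hcl : IsClosed K) {l : List Plane} (h : IsBoundaryArc s K p q l) :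
    pathLength l = ‖q - s‖ - ‖p - s‖ ∨ ∃ σ : ℝ, (σ = 1 ∨ σ = -1) ∧ (∃ b, StrictEdge σ s K p b) ∧
      q ∈ K ∧ 0 < σ * cross (p - s) (q - s) ∧ pathLength l ≤ 2 * dist p q ∧
      dist p q ^ 2 ≤ ‖q - s‖ ^ 2 - ‖p - s‖ ^ 2 := by
  cases h with
  | point p => left; simp [pathLength]
  | edge _ b _ l hab hinc htail =>
    have h2 := htail.pathLength_cons p []
    simp only [List.append_nil] at h2
    have hlt := norm_lt_of_strictMonoOn hinc
    have hpK : p ∈ K := hcl.frontier_subset (hab (left_mem_segment ℝ p b)).1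
    have key : ∀ σ : ℝ, (σ = 1 ∨ σ = -1) → StrictEdge σ s K p b →
        ∃ σ : ℝ, (σ = 1 ∨ σ = -1) ∧ (∃ b, StrictEdge σ s K p b) ∧
          q ∈ K ∧ 0 < σ * cross (p - s) (q - s) ∧ pathLength (p :: l) ≤ 2 * dist p q ∧
          dist p q ^ 2 ≤ ‖q - s‖ ^ 2 - ‖p - s‖ ^ 2 := by
      intro σ hσ hs
      have hσ2 : σ ^ 2 = 1 := by rcases hσ with rfl | rfl <;> norm_num
      have hσa : |σ| = 1 := by rcases hσ with rfl | rfl <;> norm_num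
      obtain ⟨i1, i2⟩ := htail.of_strict hσ2 hK hcl p hs
      have hq : q ∈ K := IsBoundaryArc.end_mem hcl htail hs.right_mem
      have hpq := hs.turn_trans hq i1
      have h3 := hs.norm_mul_norm_le hσ2 hq hpq.le
      have h4 := hs.dot_nonneg hq hpq.le
      refine ⟨σ, hσ, ⟨b, hs⟩, hq, hpq, ?_, ?_⟩
      · have e1 : dot (q - s) (q - p) = dot (q - s) (b - p) + dot (q - s) (q - b) := by
          simp only [dot, PiLp.sub_apply]; ring
        have e2 : cross (q - s) (q - p) = cross (q - s) (b - p) + cross (q - s) (q - b) := by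
          simp only [cross, PiLp.sub_apply]; ring
        have e3 := (le_abs_self _).trans (abs_dot_le (q - s) (q - p))
        have e4 : σ * cross (q - s) (q - p) ≤ ‖q - s‖ * ‖q - p‖ := by
          refine (le_abs_self _).trans ?_
          rw [abs_mul, hσa, one_mul]
          exact abs_cross_le _ _
        have hpos : 0 < ‖q - s‖ := by
          refine norm_pos_iff.2 fun h0 => ?_
          rw [h0] at hpq
          simp [cross] at hpq
        rw [h2, dist_comm p q, dist_eq_norm q p]
        refine le_of_mul_le_mul_left ?_ hpos
        rw [e1] at e3
        rw [e2] at e4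
        linarith
      · rw [dist_comm, dist_eq_norm, norm_sq_eq, norm_sq_eq, norm_sq_eq]
        simp only [dot, PiLp.sub_apply] at h4 ⊢
        nlinarith
    rcases edge_radial_or_strict (σ := 1) (by norm_num) hK hcl hab hinc with
      ⟨ν, hν0, hν1, hν⟩ | hs | hs
    · left
      have hb : b ≠ s := by
        rintro rfl
        rw [sub_self, norm_zero] at hlt
        exact (norm_nonneg _).not_gt hlt
      obtain ⟨-, hlen⟩ := htail.of_radial hK hcl p hpK ν hν1 hν hb
      have hdc : dist p b = ‖b - s‖ - ‖p - s‖ := by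
        rw [dist_comm, dist_eq_norm]
        have : b - p = (1 - ν) • (b - s) := by rw [sub_smul, ← hν]; simp
        rw [this, norm_smul, Real.norm_of_nonneg (by linarith), hν, norm_smul,
          Real.norm_of_nonneg hν0]
        ring
      rw [h2, hlen, hdc]
      ring
    · exact .inr (key 1 (.inl rfl) hs)
    · exact .inr (key (-1) (.inr rfl) hs)

/-! ### The upper bound for the length -/

variable {h : ℕ} {P : ConvexPolygonWithHoles h}

theorem _root_.IsConvexPolygon.convex {K : Set Plane} (hK : IsConvexPolygon K) : Convex ℝ K := by
  obtain ⟨⟨V, rfl⟩, -⟩ := hK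
  exact convex_convexHull ℝ _

theorem _root_.IsConvexPolygon.isCompact {K : Set Plane} (hK : IsConvexPolygon K) :
    IsCompact K := by
  obtain ⟨⟨V, rfl⟩, -⟩ := hK
  exact V.finite_toSet.isCompact_convexHull (𝕜 := ℝ)

theorem _root_.IsConvexPolygon.isClosed {K : Set Plane} (hK : IsConvexPolygon K) : IsClosed K :=
  hK.isCompact.isClosed

theorem isBounded_carrier (P : ConvexPolygonWithHoles h) : Bornology.IsBounded P.carrier :=
  P.outer_polygon.isCompact.isBounded.subset Set.sdiff_subset

theorem isClosed_carrier (P : ConvexPolygonWithHoles h) : IsClosed P.carrier :=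
  P.outer_polygon.isClosed.sdiff (isOpen_iUnion fun _ => isOpen_interior)

theorem mem_carrier_of_mem_hole {x : Plane} {i : Fin h} (hx : x ∈ P.hole i)
    (hx' : x ∉ interior (P.hole i)) : x ∈ P.carrier := by
  refine ⟨interior_subset (P.hole_subset i hx), fun hU => ?_⟩
  obtain ⟨j, hj⟩ := Set.mem_iUnion.1 hU
  by_cases hij : i = j
  · exact hx' (hij ▸ hj)
  · exact Set.disjoint_left.1 (P.hole_disjoint i j hij) hx (interior_subset hj)

theorem _root_.IsGreedyFrom.head?_eq {s p v : Plane} {l : List Plane}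
    (hl : IsGreedyFrom P s p v l) : l.head? = some p := by
  cases hl <;> rfl

/-- A tangent point that ends a counterclockwise (clockwise) arc is the extreme one. -/
theorem tangent_side {σ : ℝ} (hσ : σ = 1 ∨ σ = -1) {s q t : Plane} {K : Set Plane}
    (ht : IsLeftTangentPoint s K t ∨ IsRightTangentPoint s K t) (hq : q ∈ K)
    (hqt : 0 < σ * cross (q - s) (t - s)) : ∀ x ∈ K, σ * cross (t - s) (x - s) ≤ 0 := by
  have e : cross (t - s) (q - s) = -cross (q - s) (t - s) := by
    simp only [cross]; ring
  intro x hx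
  rcases ht with ⟨-, -, ht⟩ | ⟨-, -, ht⟩ <;> rcases hσ with rfl | rfl
  · linarith [ht q hq]
  · linarith [ht x hx]
  · linarith [ht x hx]
  · linarith [ht q hq]

/-- The extreme point `t` is not turned back from `a`, so `dot_nonneg` applies to it; and `t = a` is
impossible because the edge turns beyond `a`. This excludes a second arc on the same hole with the
same orientation. -/
theorem StrictEdge.norm_lt_of_tangent {σ : ℝ} {s a b t : Plane} {K : Set Plane}
    (h : StrictEdge σ s K a b) (htK : t ∈ K) (ht : ∀ x ∈ K, σ * cross (t - s) (x - s) ≤ 0) :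
    ‖a - s‖ < ‖t - s‖ := by
  have h1 : 0 ≤ σ * cross (a - s) (t - s) := by
    have e : cross (t - s) (a - s) = -cross (a - s) (t - s) := by
      simp only [cross]; ring
    have := ht a h.left_mem
    rw [e] at this
    linarith
  have h2 := h.dot_nonneg htK h1
  have hne : t - a ≠ 0 := by
    intro h0
    obtain rfl := sub_eq_zero.1 h0
    exact (ht b h.right_mem).not_gt h.turn
  have h3 := dot_self_pos hne
  rw [norm_lt_norm_iff_dot]
  simp only [dot, PiLp.sub_apply] at *
  nlinarith

theorem norm_sub_of_ray {s p v : Plane} (hv : p = s ∨ v = p - s) {t : ℝ} (ht : 0 ≤ t) :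
    dist p (p + t • v) = ‖p + t • v - s‖ - ‖p - s‖ := by
  rw [dist_comm, dist_eq_norm, add_sub_cancel_left]
  rcases hv with rfl | rfl
  · simp
  · have : p + t • (p - s) - s = (1 + t) • (p - s) := by module
    rw [this, norm_smul, norm_smul, Real.norm_of_nonneg ht, Real.norm_of_nonneg (by linarith)]
    ring

/-- The sign of an orientation. -/
def sgn (σ : Bool) : ℝ := if σ then 1 else -1

/-- The length of a greedy path is controlled by one number per hole and orientation: the lengths
of the chords of the non-radial arcs. -/
theorem exists_chords {s p v : Plane} {l : List Plane} {R : ℝ}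
    (hR : ∀ x ∈ P.carrier, ‖x - s‖ ≤ R) (hl : IsGreedyFrom P s p v l) (hv : p = s ∨ v = p - s) :
    ∃ f : Fin h × Bool → ℝ, pathLength l ≤ R - ‖p - s‖ + 2 * ∑ k, f k ∧
      ∑ k, f k ^ 2 ≤ R ^ 2 - ‖p - s‖ ^ 2 ∧
      ∀ i σ, f (i, σ) ≠ 0 →
        ∃ a b, StrictEdge (sgn σ) s (P.hole i) a b ∧ ‖p - s‖ ≤ ‖a - s‖ := by
  induction hl with
  | exit p v q ray hit =>
    obtain ⟨t, ht, rfl, hseg, -⟩ := ray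
    refine ⟨0, ?_, ?_, by simp⟩
    · have := hR _ (hseg (right_mem_segment ℝ _ _))
      simp only [pathLength, norm_sub_of_ray hv ht, Pi.zero_apply, Finset.sum_const_zero]
      linarith
    · have := hR _ (hseg (left_mem_segment ℝ _ _))
      simp only [Pi.zero_apply, ne_eq, OfNat.ofNat_ne_zero, not_false_eq_true, zero_pow,
        Finset.sum_const_zero]
      nlinarith [norm_nonneg (p - s)]
  | turn p v q t i arc rest ray hit tangent along next ih =>
    obtain ⟨f, hf1, hf2, hf3⟩ := ih (.inr rfl)
    obtain ⟨r, hr, rfl, hseg, -⟩ := ray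
    have hd := norm_sub_of_ray hv hr
    have hpq : ‖p - s‖ ≤ ‖p + r • v - s‖ := by
      have : 0 ≤ dist p (p + r • v) := dist_nonneg
      linarith
    have hqt := along.norm_le
    have hlen : pathLength (p :: (arc ++ rest)) =
        dist p (p + r • v) + (pathLength arc + pathLength rest) := by
      rw [along.pathLength_cons, along.pathLength_append next.head?_eq]
    have hcl := (P.hole_polygon i).isClosed
    have hqK := hcl.frontier_subset hit
    rw [hlen, hd]
    rcases along.radial_or_strict (P.hole_polygon i).convex hcl with
      hrad | ⟨σ, hσ, ⟨b, hb⟩, htK, hturn, hlen', hsq⟩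
    · refine ⟨f, by linarith, hf2.trans ?_, fun j τ hj => ?_⟩
      · have := pow_le_pow_left₀ (norm_nonneg _) (hpq.trans hqt) 2
        linarith
      · obtain ⟨a, b, hab, hle⟩ := hf3 j τ hj
        exact ⟨a, b, hab, (hpq.trans hqt).trans hle⟩
    · obtain ⟨τ, rfl⟩ : ∃ τ, sgn τ = σ := by
        rcases hσ with rfl | rfl
        · exact ⟨true, rfl⟩
        · exact ⟨false, rfl⟩
      have hside := tangent_side hσ tangent hqK hturn
      -- A nonzero entry would come from a later strict edge of this hole and orientation, starting
      -- at distance at least `‖t - s‖`, whereas all such edges start closer to `s` than `t`.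
      have hf0 : f (i, τ) = 0 := by
        by_contra hne
        obtain ⟨a, b, hab, hle⟩ := hf3 i τ hne
        exact (hab.norm_lt_of_tangent htK hside).not_ge hle
      refine ⟨Function.update f (i, τ) (dist (p + r • v) t), ?_, ?_, ?_⟩
      · rw [Finset.sum_update_of_mem (Finset.mem_univ _)]
        have := Finset.sum_sdiff_eq_sub (f := f) (Finset.subset_univ {(i, τ)})
        rw [Finset.sum_singleton, hf0] at this
        linarith
      · have e : ∀ k, Function.update f (i, τ) (dist (p + r • v) t) k ^ 2 =
            Function.update (fun k => f k ^ 2) (i, τ) (dist (p + r • v) t ^ 2) k := by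
          intro k
          by_cases hk : k = (i, τ)
          · subst hk; simp
          · simp [hk]
        rw [Finset.sum_congr rfl fun k _ => e k, Finset.sum_update_of_mem (Finset.mem_univ _)]
        have := Finset.sum_sdiff_eq_sub (f := fun k => f k ^ 2) (Finset.subset_univ {(i, τ)})
        rw [Finset.sum_singleton, hf0] at this
        have := pow_le_pow_left₀ (norm_nonneg _) hpq 2
        linarith
      · intro j ρ hj
        by_cases hk : (j, ρ) = (i, τ)
        · obtain ⟨rfl, rfl⟩ := Prod.mk.inj hk
          exact ⟨_, b, hb, hpq⟩
        · rw [Function.update_of_ne hk] at hj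
          obtain ⟨a, b, hab, hle⟩ := hf3 j ρ hj
          exact ⟨a, b, hab, (hpq.trans hqt).trans hle⟩

theorem pathLength_le (hh : 1 ≤ h) {s u : Plane} (hs : s ∈ P.carrier) {l : List Plane}
    (hl : IsGreedyPath P s u l) : pathLength l ≤ 4 * √(h : ℝ) * P.diam₂ := by
  have hR : ∀ x ∈ P.carrier, ‖x - s‖ ≤ P.diam₂ := fun x hx => by
    rw [← dist_eq_norm]
    exact Metric.dist_le_diam_of_mem (isBounded_carrier P) hx hs
  have hR0 : 0 ≤ P.diam₂ := Metric.diam_nonneg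
  obtain ⟨f, hf1, hf2, -⟩ := exists_chords hR hl (.inl rfl)
  rw [sub_self, norm_zero] at hf1 hf2
  have hcs := sq_sum_le_card_mul_sum_sq (s := Finset.univ) (f := f)
  have hcard : ((Finset.univ : Finset (Fin h × Bool)).card : ℝ) = 2 * h := by
    simp [mul_comm]
  rw [hcard] at hcs
  have h1 : (1 : ℝ) ≤ √(h : ℝ) := Real.one_le_sqrt.2 (by exact_mod_cast hh)
  have hsq : √(h : ℝ) ^ 2 = h := Real.sq_sqrt (Nat.cast_nonneg h)
  -- Cauchy–Schwarz over `2 * h` entries, with `√2 ≤ 3 / 2`; together with the radial part this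
  -- gives `1 + 3 * √h ≤ 4 * √h` times the diameter.
  have h2 : ∑ k, f k ≤ 3 / 2 * √(h : ℝ) * P.diam₂ := by
    apply le_of_sq_le_sq _ (by positivity)
    calc (∑ k, f k) ^ 2 ≤ 2 * h * P.diam₂ ^ 2 := hcs.trans (by
          apply mul_le_mul_of_nonneg_left _ (by positivity); linarith)
      _ = 2 * √(h : ℝ) ^ 2 * P.diam₂ ^ 2 := by rw [hsq]
      _ ≤ _ := by nlinarith [mul_nonneg (sq_nonneg √(h : ℝ)) (sq_nonneg P.diam₂)]
  nlinarith [mul_le_mul_of_nonneg_right h1 hR0]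

/-! ### Existence: following the boundary of a hole -/

theorem exists_support {σ : ℝ} (hσ : σ ^ 2 = 1) {K : Set Plane} (hK : Convex ℝ K)
    (hint : (interior K).Nonempty) {q : Plane} (hq : q ∉ interior K) :
    ∃ n : Plane, n ≠ 0 ∧ ∀ x ∈ K, σ * cross n (x - q) ≤ 0 := by
  obtain ⟨f, hf⟩ := geometric_hahn_banach_open_point hK.interior isOpen_interior hq
  have hf' : ∀ x ∈ K, f x ≤ f q := by
    intro x hx
    have hx' : x ∈ closure (interior K) := by
      rw [hK.closure_interior_eq_closure_of_nonempty_interior hint]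
      exact subset_closure hx
    exact closure_minimal (fun y hy => (hf y hy).le)
      (isClosed_le f.continuous continuous_const) hx'
  have hrep : ∀ x : Plane, f x = x 0 * f !₂[1, 0] + x 1 * f !₂[0, 1] := by
    intro x
    have : x = x 0 • !₂[(1 : ℝ), 0] + x 1 • !₂[(0 : ℝ), 1] := by
      apply plane_ext <;> simp
    conv_lhs => rw [this]
    simp
  -- Every linear functional of the plane is a cross product with its rotated gradient; the two
  -- factors `σ` cancel.
  have hcr : ∀ x : Plane, σ * cross !₂[σ * f !₂[0, 1], -(σ * f !₂[1, 0])] (x - q) = f x - f q := by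
    intro x
    rw [hrep x, hrep q]
    simp only [cross, PiLp.sub_apply, Matrix.cons_val_zero, Matrix.cons_val_one]
    linear_combination (f !₂[0, 1] * (x 1 - q 1) + f !₂[1, 0] * (x 0 - q 0)) * hσ
  refine ⟨!₂[σ * f !₂[0, 1], -(σ * f !₂[1, 0])], fun h0 => ?_, fun x hx => ?_⟩
  · obtain ⟨x, hx⟩ := hint
    have h1 := hcr x
    have h2 := hf x hx
    rw [h0] at h1
    simp only [cross, PiLp.zero_apply, zero_mul, sub_zero, mul_zero] at h1
    linarith
  · rw [hcr]
    linarith [hf' x hx]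

/-- From a boundary point of a polygon, the boundary leads along an edge to a vertex, in either
orientation. -/
theorem exists_next_vertex {σ : ℝ} (hσ : σ ^ 2 = 1) {V : Finset Plane} {q : Plane}
    (hint : (interior (convexHull ℝ (V : Set Plane))).Nonempty)
    (hq : q ∉ interior (convexHull ℝ (V : Set Plane))) :
    ∃ v ∈ V, v ≠ q ∧ ∀ x ∈ convexHull ℝ (V : Set Plane), σ * cross (v - q) (x - q) ≤ 0 := by
  have hσ0 : σ ≠ 0 := by rintro rfl; norm_num at hσ
  obtain ⟨n, hn, hs⟩ := exists_support hσ (convex_convexHull ℝ _) hint hq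
  have hN := dot_self_pos hn
  have key : ∀ v x : Plane, dot n n * (σ * cross (v - q) (x - q)) =
      dot n (v - q) * (σ * cross n (x - q)) - σ * cross n (v - q) * dot n (x - q) := by
    intro v x
    simp only [dot, cross]; ring
  have hV : ∀ x ∈ V, σ * cross n (x - q) ≤ 0 := fun x hx => hs x (subset_convexHull ℝ _ hx)
  by_cases hex : ∃ v ∈ V, σ * cross n (v - q) = 0 ∧ 0 < dot n (v - q)
  · obtain ⟨v, hv, h0, hpos⟩ := hex
    refine ⟨v, hv, fun h => by simp [h, dot] at hpos, fun x hx => ?_⟩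
    have h1 := key v x
    rw [h0, zero_mul, sub_zero] at h1
    have h2 := mul_nonpos_of_nonneg_of_nonpos hpos.le (hs x hx)
    rw [← h1] at h2
    exact nonpos_of_mul_nonpos_right h2 hN
  · push Not at hex
    have hne : (V.filter fun x => σ * cross n (x - q) < 0).Nonempty := by
      by_contra hemp
      rw [Finset.not_nonempty_iff_eq_empty, Finset.filter_eq_empty_iff] at hemp
      have h1 : ∀ x ∈ convexHull ℝ (V : Set Plane), -σ * cross n (x - q) ≤ 0 :=
        convexHull_subset_halfPlane fun x hx => by linarith [not_lt.1 (hemp hx)]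
      obtain ⟨x, hx⟩ := hint
      have h2 := cross_neg_of_mem_interior hσ0 hn hs hx
      linarith [h1 x (interior_subset hx)]
    -- No vertex lies ahead on the supporting line itself, so the next one is the vertex at the
    -- smallest angle from `n`, that is, with the largest cotangent.
    obtain ⟨v, hv, hmax⟩ := Finset.exists_max_image _
      (fun x => dot n (x - q) / -(σ * cross n (x - q))) hne
    obtain ⟨hvV, hvn⟩ := Finset.mem_filter.1 hv
    refine ⟨v, hvV, fun h => by simp [h, cross] at hvn, convexHull_subset_halfPlane fun x hx => ?_⟩
    refine nonpos_of_mul_nonpos_right ?_ hN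
    rw [key]
    rcases (hV x hx).lt_or_eq with hx0 | hx0
    · have := hmax x (Finset.mem_filter.2 ⟨hx, hx0⟩)
      rw [div_le_div_iff₀ (by linarith) (by linarith)] at this
      linarith
    · rw [hx0, mul_zero, zero_sub]
      nlinarith [hex x hx hx0]

theorem segment_subset_nearSide {σ : ℝ} (hσ : σ ≠ 0) {s a b : Plane} {K : Set Plane}
    (hK : Convex ℝ K) (ha : a ∈ K) (hb : b ∈ K) (hab : a ≠ b)
    (hturn : 0 ≤ σ * cross (a - s) (b - s))
    (hside : ∀ x ∈ K, σ * cross (b - a) (x - a) ≤ 0) : segment ℝ a b ⊆ nearSide s K := by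
  rintro _ ⟨α, β, hα, hβ, hs, rfl⟩
  have hw : b - a ≠ 0 := sub_ne_zero.2 hab.symm
  have hα' : α = 1 - β := by linarith
  subst hα'
  refine ⟨⟨subset_closure (hK ha hb hα hβ hs), fun hi => ?_⟩, Set.disjoint_left.2 ?_⟩
  · have := cross_neg_of_mem_interior hσ hw hside hi
    have e : cross (b - a) ((1 - β) • a + β • b - a) = 0 := by
      simp only [cross, PiLp.sub_apply, PiLp.add_apply, PiLp.smul_apply, smul_eq_mul]; ring
    rw [e, mul_zero] at this
    exact this.false
  · rintro _ ⟨θ, η, hθ, hη, hθη, rfl⟩ hi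
    have := cross_neg_of_mem_interior hσ hw hside hi
    have hη' : η = 1 - θ := by linarith
    subst hη'
    have e : cross (b - a) (θ • s + (1 - θ) • ((1 - β) • a + β • b) - a) =
        θ * cross (a - s) (b - s) := by
      simp only [cross, PiLp.sub_apply, PiLp.add_apply, PiLp.smul_apply, smul_eq_mul]; ring
    rw [e] at this
    nlinarith

theorem strictMonoOn_dist {s a b : Plane} (hab : a ≠ b) (hd : 0 ≤ dot (a - s) (b - a)) :
    StrictMonoOn (fun t : ℝ => dist s (AffineMap.lineMap a b t)) (Set.Icc 0 1) := by
  intro t ht t' ht' hlt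
  have hW := dot_self_pos (sub_ne_zero.2 hab.symm)
  refine lt_of_pow_lt_pow_left₀ 2 dist_nonneg ?_
  change dist s _ ^ 2 < dist s _ ^ 2
  rw [dist_sq_lineMap, dist_sq_lineMap]
  have h1 := mul_nonneg (sub_pos.2 hlt).le hd
  have h2 : t ^ 2 < t' ^ 2 := pow_lt_pow_left₀ hlt ht.1 two_ne_zero
  have h3 := mul_pos (sub_pos.2 h2) hW
  linarith

theorem StrictEdge.ne {σ : ℝ} {s a b : Plane} {K : Set Plane} (h : StrictEdge σ s K a b) :
    a ≠ b := by
  rintro rfl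
  have := h.turn
  simp [cross, mul_comm] at this

theorem StrictEdge.isBoundaryArc {σ : ℝ} {s a b t : Plane} {K : Set Plane} (hK : Convex ℝ K)
    (h : StrictEdge σ s K a b) {l : List Plane} (hl : IsBoundaryArc s K b t l) :
    IsBoundaryArc s K a t (a :: l) := by
  have hσ : σ ≠ 0 := by
    rintro rfl
    simpa using h.turn
  exact .edge a b t l
    (segment_subset_nearSide hσ hK h.left_mem h.right_mem h.ne h.turn.le h.side)
    (strictMonoOn_dist h.ne h.out) hl

theorem StrictEdge.norm_lt {σ : ℝ} {s a b : Plane} {K : Set Plane} (h : StrictEdge σ s K a b) :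
    ‖a - s‖ < ‖b - s‖ :=
  norm_lt_of_strictMonoOn (strictMonoOn_dist h.ne h.out)

theorem tangent_of_side {σ : ℝ} (hσ : σ = 1 ∨ σ = -1) {s t : Plane} {K : Set Plane} (ht : t ∈ K)
    (hts : t ≠ s) (h : ∀ x ∈ K, σ * cross (t - s) (x - s) ≤ 0) :
    IsLeftTangentPoint s K t ∨ IsRightTangentPoint s K t := by
  rcases hσ with rfl | rfl
  · exact .inr ⟨ht, hts, fun x hx => by linarith [h x hx]⟩
  · exact .inl ⟨ht, hts, fun x hx => by linarith [h x hx]⟩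

/-- After a strict edge, the next edge is strict as well, or its starting point is a point of
tangency. -/
theorem StrictEdge.next {σ : ℝ} (hσ : σ ^ 2 = 1) {s a b c : Plane} {K : Set Plane}
    (hint : (interior K).Nonempty) (h : StrictEdge σ s K a b) (hc : c ∈ K) (hcb : c ≠ b)
    (hside : ∀ x ∈ K, σ * cross (c - b) (x - b) ≤ 0) :
    StrictEdge σ s K b c ∨ ∀ x ∈ K, σ * cross (b - s) (x - s) ≤ 0 := by
  have hσ0 : σ ≠ 0 := by rintro rfl; norm_num at hσ
  have hB := dot_self_pos h.right_ne
  have hww : σ * cross (b - a) (c - b) ≤ 0 := by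
    have := h.side c hc
    have e : cross (b - a) (c - a) = cross (b - a) (c - b) := by
      simp only [cross, PiLp.sub_apply]; ring
    rwa [e] at this
  have eBw : cross (b - s) (b - a) = cross (a - s) (b - s) := by
    simp only [cross, PiLp.sub_apply]; ring
  have eBc : cross (b - s) (c - b) = cross (b - s) (c - s) := by
    simp only [cross, PiLp.sub_apply]; ring
  have hturn := h.turn
  rcases lt_or_ge 0 (σ * cross (b - s) (c - s)) with hpos | hneg
  · left
    refine ⟨h.right_mem, hc, hpos, ?_, hside⟩
    have id := congrArg (σ * ·) (dot_self_mul_cross (b - s) (b - a) (c - b))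
    simp only [eBw, eBc] at id
    have e : dot (b - s) (b - a) = dot (a - s) (b - a) + dot (b - a) (b - a) := by
      simp only [dot, PiLp.sub_apply]; ring
    have p0 : 0 ≤ dot (b - s) (b - a) := by
      rw [e, ← norm_sq_eq_dot]
      have := h.out
      positivity
    have p1 := mul_nonneg p0 hpos.le
    have p2 := mul_nonneg hB.le (neg_nonneg.2 hww)
    have : 0 ≤ (σ * cross (a - s) (b - s)) * dot (b - s) (c - b) := by linarith
    exact nonneg_of_mul_nonneg_right this hturn
  · right
    -- The tangent condition at `b` is a nonnegative combination of the side conditions of the two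
    -- edges meeting there.
    have id : ∀ x : Plane, -(σ * cross (b - a) (c - b)) * (σ * cross (b - s) (x - s)) =
        -(σ * cross (b - s) (c - s)) * (σ * cross (b - a) (x - a)) +
          (σ * cross (a - s) (b - s)) * (σ * cross (c - b) (x - b)) := by
      intro x
      simp only [cross, PiLp.sub_apply]; ring
    rcases hww.lt_or_eq with hlt | heq
    · intro x hx
      have p1 := mul_nonpos_of_nonneg_of_nonpos (neg_nonneg.2 hneg) (h.side x hx)
      have p2 := mul_nonpos_of_nonneg_of_nonpos hturn.le (hside x hx)
      have : -(σ * cross (b - a) (c - b)) * (σ * cross (b - s) (x - s)) ≤ 0 := by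
        rw [id]; linarith
      exact nonpos_of_mul_nonpos_right this (by linarith)
    · exfalso
      obtain ⟨x, hx⟩ := hint
      have h2 := cross_neg_of_mem_interior hσ0 (sub_ne_zero.2 hcb) hside hx
      have p1 := mul_nonpos_of_nonneg_of_nonpos (neg_nonneg.2 hneg)
        (h.side x (interior_subset hx))
      have p2 := mul_neg_of_pos_of_neg hturn h2
      have := id x
      rw [heq, neg_zero, zero_mul] at this
      linarith

/-- Each further strict edge leads to a vertex farther from `s`, so the number of vertices beyond
`b` decreases until `StrictEdge.next` yields a tangent point. -/
theorem StrictEdge.exists_arc {σ : ℝ} (hσ : σ = 1 ∨ σ = -1) {s : Plane} {V : Finset Plane}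
    (hint : (interior (convexHull ℝ (V : Set Plane))).Nonempty) {a b : Plane} (hb : b ∈ V)
    (h : StrictEdge σ s (convexHull ℝ (V : Set Plane)) a b) :
    ∃ t ∈ V, ∃ l, IsBoundaryArc s (convexHull ℝ (V : Set Plane)) b t l ∧
      (IsLeftTangentPoint s (convexHull ℝ (V : Set Plane)) t ∨
        IsRightTangentPoint s (convexHull ℝ (V : Set Plane)) t) := by
  have hσ2 : σ ^ 2 = 1 := by rcases hσ with rfl | rfl <;> norm_num
  have hσ0 : σ ≠ 0 := by rintro rfl; norm_num at hσ2
  induction hn : (V.filter fun v => ‖b - s‖ < ‖v - s‖).card using Nat.strong_induction_on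
    generalizing a b with
  | _ n ih =>
    have hb' : b ∉ interior (convexHull ℝ (V : Set Plane)) :=
      (segment_subset_nearSide hσ0 (convex_convexHull ℝ _) h.left_mem h.right_mem h.ne
        h.turn.le h.side (right_mem_segment ℝ a b)).1.2
    obtain ⟨c, hc, hcb, hside⟩ := exists_next_vertex hσ2 hint hb'
    rcases h.next hσ2 hint (subset_convexHull ℝ _ hc) hcb hside with hbc | htan
    · obtain ⟨t, ht, l, hl, htan⟩ := ih _ (by
        rw [← hn]
        refine Finset.card_lt_card ⟨fun v hv => ?_, fun hsub => ?_⟩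
        · rw [Finset.mem_filter] at hv ⊢
          exact ⟨hv.1, hbc.norm_lt.trans hv.2⟩
        · have := hsub (Finset.mem_filter.2 ⟨hc, hbc.norm_lt⟩)
          exact lt_irrefl _ (Finset.mem_filter.1 this).2) hc hbc rfl
      exact ⟨t, ht, b :: l, hbc.isBoundaryArc (convex_convexHull ℝ _) hl, htan⟩
    · exact ⟨b, hb, [b], .point b,
        tangent_of_side hσ h.right_mem (sub_ne_zero.1 h.right_ne) htan⟩

/-- The hypothesis `h` covers a start on the hole itself and a ray that enters the interior just
behind `q`. The strict gain in distance serves termination. -/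
theorem exists_arc {s q : Plane} {V : Finset Plane}
    (hint : (interior (convexHull ℝ (V : Set Plane))).Nonempty)
    (hq : q ∈ convexHull ℝ (V : Set Plane)) (hq' : q ∉ interior (convexHull ℝ (V : Set Plane)))
    (h : q = s ∨ ∃ x ∈ interior (convexHull ℝ (V : Set Plane)), ∃ κ : ℝ, 0 < κ ∧
      x - q = κ • (q - s)) :
    ∃ t ∈ V, ∃ l, IsBoundaryArc s (convexHull ℝ (V : Set Plane)) q t l ∧
      (IsLeftTangentPoint s (convexHull ℝ (V : Set Plane)) t ∨
        IsRightTangentPoint s (convexHull ℝ (V : Set Plane)) t) ∧ ‖q - s‖ < ‖t - s‖ := by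
  have hK := convex_convexHull ℝ (V : Set Plane)
  obtain ⟨v, hv, hvq, hside⟩ := exists_next_vertex (σ := 1) (by norm_num) hint hq'
  have hvK := subset_convexHull ℝ _ hv
  rcases h with rfl | ⟨x, hx, κ, hκ, hxq⟩
  -- An edge starting at `s` is radial, and its line supports the hole, so its end is already a
  -- tangent point.
  · refine ⟨v, hv, [q, v], .edge q v v [v] (segment_subset_nearSide one_ne_zero hK hq hvK hvq.symm
      ?_ hside) (strictMonoOn_dist hvq.symm (by simp [dot])) (.point v),
      tangent_of_side (.inl rfl) hvK hvq hside, ?_⟩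
    · simp [cross]
    · rw [sub_self, norm_zero, norm_pos_iff]
      exact sub_ne_zero.2 hvq
  · obtain ⟨v', hv', hvq', hside'⟩ := exists_next_vertex (σ := -1) (by norm_num) hint hq'
    have hvK' := subset_convexHull ℝ _ hv'
    have h1 := cross_neg_of_mem_interior one_ne_zero (sub_ne_zero.2 hvq) hside hx
    have h2 := cross_neg_of_mem_interior (by norm_num) (sub_ne_zero.2 hvq') hside' hx
    have e : ∀ y : Plane, cross (y - q) (x - q) = -κ * cross (q - s) (y - s) := by
      intro y
      rw [hxq]; simp only [cross, PiLp.sub_apply, PiLp.smul_apply, smul_eq_mul]; ring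
    have e' : ∀ y : Plane, cross (q - s) (y - q) = cross (q - s) (y - s) := by
      intro y
      simp only [cross, PiLp.sub_apply]; ring
    rw [e] at h1 h2
    have c1 : 0 < 1 * cross (q - s) (v - s) := by nlinarith
    have c2 : 0 < -1 * cross (q - s) (v' - s) := by nlinarith
    have finish : ∀ σ : ℝ, (σ = 1 ∨ σ = -1) → ∀ w ∈ V,
        StrictEdge σ s (convexHull ℝ (V : Set Plane)) q w →
        ∃ t ∈ V, ∃ l, IsBoundaryArc s (convexHull ℝ (V : Set Plane)) q t l ∧
          (IsLeftTangentPoint s (convexHull ℝ (V : Set Plane)) t ∨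
            IsRightTangentPoint s (convexHull ℝ (V : Set Plane)) t) ∧ ‖q - s‖ < ‖t - s‖ := by
      intro σ hσ w hw hs
      obtain ⟨t, ht, l, hl, htan⟩ := hs.exists_arc hσ hint hw
      exact ⟨t, ht, q :: l, hs.isBoundaryArc hK hl, htan, hs.norm_lt.trans_le hl.norm_le⟩
    rcases le_or_gt 0 (dot (q - s) (v - q)) with d1 | d1
    · exact finish 1 (.inl rfl) v hv ⟨hq, hvK, c1, d1, hside⟩
    rcases le_or_gt 0 (dot (q - s) (v' - q)) with d2 | d2
    · exact finish (-1) (.inr rfl) v' hv' ⟨hq, hvK', c2, d2, hside'⟩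
    -- If both boundary directions at `q` approached `s`, the hole would be contained in a wedge
    -- opening towards `s`, and the ray could not enter it at `q`.
    exfalso
    have id := dot_self_mul_cross (q - s) (v - q) (v' - q)
    rw [e', e'] at id
    have h3 := hside v' hvK'
    have h4 := mul_pos_of_neg_of_neg d1 (show cross (q - s) (v' - s) < 0 by linarith)
    have h5 := mul_neg_of_pos_of_neg (show 0 < cross (q - s) (v - s) by linarith) d2
    have hqs : q - s ≠ 0 := by
      intro h0
      simp [h0, cross] at c1
    have := mul_nonneg (dot_self_pos hqs).le (show 0 ≤ -cross (v - q) (v' - q) by linarith)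
    linarith

/-! ### Existence: rays in the domain and termination -/

/-- A ray in a closed bounded set has a last point before it leaves the set. -/
theorem exists_last_point {D : Set Plane} (hcl : IsClosed D) (hbd : Bornology.IsBounded D)
    {p v : Plane} (hp : p ∈ D) (hv : v ≠ 0) :
    ∃ τ : ℝ, 0 ≤ τ ∧ segment ℝ p (p + τ • v) ⊆ D ∧
      ∃ᶠ r in 𝓝[>] (0 : ℝ), p + τ • v + r • v ∉ D := by
  let T : Set ℝ := {t | 0 ≤ t ∧ p + t • v ∉ D}
  have hT : T.Nonempty := by
    obtain ⟨R, hR⟩ := hbd.exists_norm_le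
    have hvn := norm_pos_iff.2 hv
    refine ⟨(|R| + 1 + ‖p‖) / ‖v‖, by positivity, fun hD => ?_⟩
    have h1 := hR _ hD
    have h2 : ‖((|R| + 1 + ‖p‖) / ‖v‖) • v‖ ≤ _ := norm_le_add_norm_add _ p
    rw [norm_smul, Real.norm_of_nonneg (by positivity), div_mul_cancel₀ _ hvn.ne',
      add_comm _ p] at h2
    linarith [le_abs_self R]
  have hTb : BddBelow T := ⟨0, fun t ht => ht.1⟩
  have hlt : ∀ t, 0 ≤ t → t < sInf T → p + t • v ∈ D := by
    intro t ht0 ht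
    by_contra hD
    exact ht.not_ge (csInf_le hTb ⟨ht0, hD⟩)
  have hτ0 : 0 ≤ sInf T := le_csInf hT fun t ht => ht.1
  have hcont : Continuous fun t : ℝ => p + t • v := by fun_prop
  have hτ : p + sInf T • v ∈ D := by
    rcases hτ0.eq_or_lt with h0 | h0
    · rw [← h0, zero_smul, add_zero]; exact hp
    · have ht : Tendsto (fun t : ℝ => p + t • v) (𝓝[<] (sInf T)) (𝓝 (p + sInf T • v)) :=
        (hcont.tendsto _).mono_left nhdsWithin_le_nhds
      refine hcl.mem_of_tendsto ht ?_
      filter_upwards [self_mem_nhdsWithin, mem_nhdsWithin_of_mem_nhds (lt_mem_nhds h0)]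
        with t ht1 ht2
      exact hlt t ht2.le ht1
  refine ⟨sInf T, hτ0, ?_, ?_⟩
  · rintro _ ⟨α, β, hα, hβ, hs, rfl⟩
    have : α • p + β • (p + sInf T • v) = p + (β * sInf T) • v := by
      rw [smul_add, ← add_assoc, ← add_smul, hs, one_smul, smul_smul]
    rw [this]
    have hle : β * sInf T ≤ sInf T := mul_le_of_le_one_left hτ0 (by linarith)
    rcases hle.lt_or_eq with hlt' | heq
    · exact hlt _ (by positivity) hlt'
    · rw [heq]; exact hτ
  · rw [frequently_nhdsWithin_iff, Metric.nhds_basis_ball.frequently_iff]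
    intro ε hε
    obtain ⟨t, ht, htε⟩ := exists_lt_of_csInf_lt hT (lt_add_of_pos_right (sInf T) hε)
    have hne : sInf T ≠ t := fun h => ht.2 (h ▸ hτ)
    have hgt : sInf T < t := lt_of_le_of_ne (csInf_le hTb ht) hne
    refine ⟨t - sInf T, ?_, ?_, sub_pos.2 hgt⟩
    · rw [Metric.mem_ball, Real.dist_eq, sub_zero, abs_of_pos (sub_pos.2 hgt)]
      linarith
    · rw [add_assoc, ← add_smul, add_sub_cancel]
      exact ht.2

/-- A point at which a ray leaves the domain lies on the outer boundary, or on the boundary of a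
hole whose interior the ray enters. -/
theorem exit_or_enter_hole {q v : Plane} (hq : q ∈ P.carrier)
    (hout : ∃ᶠ r in 𝓝[>] (0 : ℝ), q + r • v ∉ P.carrier) :
    q ∈ frontier P.outer ∨ ∃ i, q ∈ frontier (P.hole i) ∧
      ∃ r : ℝ, 0 < r ∧ q + r • v ∈ interior (P.hole i) := by
  by_cases hfr : q ∈ frontier P.outer
  · exact .inl hfr
  right
  have hcont : Tendsto (fun r : ℝ => q + r • v) (𝓝[>] 0) (𝓝 q) := by
    have : Continuous fun r : ℝ => q + r • v := by fun_prop
    simpa using (this.tendsto 0).mono_left nhdsWithin_le_nhds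
  have hint : q ∈ interior P.outer := by
    by_contra hni
    exact hfr ⟨subset_closure hq.1, hni⟩
  have hev : ∀ᶠ r in 𝓝[>] (0 : ℝ), q + r • v ∈ P.outer :=
    hcont.eventually (mem_interior_iff_mem_nhds.1 hint)
  -- There are finitely many holes, so points outside the domain arbitrarily close to `q` on the ray
  -- recur in one fixed hole.
  have hfreq : ∃ i, ∃ᶠ r in 𝓝[>] (0 : ℝ), q + r • v ∈ interior (P.hole i) := by
    by_contra hno
    simp only [not_exists, not_frequently] at hno
    refine hout ?_
    filter_upwards [hev, eventually_all.2 hno] with r hr1 hr2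
    simp only [not_not]
    exact ⟨hr1, fun hU => by
      obtain ⟨i, hi⟩ := Set.mem_iUnion.1 hU
      exact hr2 i hi⟩
  obtain ⟨i, hi⟩ := hfreq
  refine ⟨i, ⟨?_, fun hqi => hq.2 (Set.mem_iUnion.2 ⟨i, hqi⟩)⟩, ?_⟩
  · rw [mem_closure_iff_frequently]
    exact hcont.frequently (hi.mono fun r hr => interior_subset hr)
  · obtain ⟨r, hr, hr0⟩ := (hi.and_eventually self_mem_nhdsWithin).exists
    exact ⟨r, hr0, hr⟩

/-- One step of the greedy algorithm. -/
theorem exit_or_turn {V : Fin h → Finset Plane}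
    (hV : ∀ i, P.hole i = convexHull ℝ (V i : Set Plane)) {s p v : Plane} (hp : p ∈ P.carrier)
    (hv0 : v ≠ 0) (hv : p = s ∨ v = p - s) :
    (∃ l, IsGreedyFrom P s p v l) ∨ ∃ i, ∃ t ∈ V i, ‖p - s‖ < ‖t - s‖ ∧ t ∈ P.carrier ∧
      ∀ rest, IsGreedyFrom P s t (t - s) rest → ∃ l, IsGreedyFrom P s p v l := by
  obtain ⟨τ, hτ, hseg, hout⟩ := exists_last_point (isClosed_carrier P) (isBounded_carrier P) hp hv0
  have hray : ReachesAlongRay P.carrier p v (p + τ • v) := by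
    refine ⟨τ, hτ, rfl, hseg, ?_⟩
    -- A ray of length zero counts only if it leaves at once; the frequent exits near the last point
    -- provide this.
    rintro rfl ε hε
    rw [zero_smul, add_zero] at hout
    have hmem : Set.Ioo 0 ε ∈ 𝓝[>] (0 : ℝ) := Ioo_mem_nhdsGT hε
    obtain ⟨r, hr, hr'⟩ := (hout.and_eventually hmem).exists
    exact ⟨r, hr'.1, hr'.2, hr⟩
  have hq : p + τ • v ∈ P.carrier := hseg (right_mem_segment ℝ _ _)
  rcases exit_or_enter_hole hq hout with hfr | ⟨i, hfr, r, hr, hri⟩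
  · exact .inl ⟨_, .exit p v _ hray hfr⟩
  right
  have hnorm : ‖p - s‖ ≤ ‖p + τ • v - s‖ := by
    have := norm_sub_of_ray hv hτ
    linarith [dist_nonneg (x := p) (y := p + τ • v)]
  have hnotint := hfr.2
  have hmem := (P.hole_polygon i).isClosed.frontier_subset hfr
  have hne := (P.hole_polygon i).2
  rw [hV i] at hnotint hmem hne hri
  obtain ⟨t, ht, arc, harc, htan, hlt⟩ := exists_arc (s := s) hne hmem hnotint (by
    rcases hv with rfl | rfl
    · rcases hτ.eq_or_lt with h0 | h0
      · left; rw [← h0, zero_smul, add_zero]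
      · refine .inr ⟨_, hri, r / τ, by positivity, ?_⟩
        rw [add_sub_cancel_left, add_sub_cancel_left, smul_smul, div_mul_cancel₀ _ h0.ne']
    · refine .inr ⟨_, hri, r / (1 + τ), by positivity, ?_⟩
      have : p + τ • (p - s) - s = (1 + τ) • (p - s) := by module
      rw [add_sub_cancel_left, this, smul_smul, div_mul_cancel₀ _ (by positivity)])
  rw [← hV i] at harc htan
  have htK : t ∈ P.hole i := by rcases htan with h | h <;> exact h.1
  have hti : t ∉ interior (P.hole i) := by
    have hside : ∃ σ : ℝ, σ ≠ 0 ∧ t - s ≠ 0 ∧ ∀ x ∈ P.hole i, σ * cross (t - s) (x - t) ≤ 0 := by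
      have e : ∀ x : Plane, cross (t - s) (x - t) = cross (t - s) (x - s) := by
        intro x; simp only [cross, PiLp.sub_apply]; ring
      simp only [e]
      rcases htan with h | h
      · exact ⟨-1, by norm_num, sub_ne_zero.2 h.2.1, fun x hx => by linarith [h.2.2 x hx]⟩
      · exact ⟨1, by norm_num, sub_ne_zero.2 h.2.1, fun x hx => by linarith [h.2.2 x hx]⟩
    obtain ⟨σ, hσ, hts, hside⟩ := hside
    intro hi
    have := cross_neg_of_mem_interior hσ hts hside hi
    simp [cross] at this
  exact ⟨i, t, ht, hnorm.trans_lt hlt, mem_carrier_of_mem_hole htK hti, fun rest hrest =>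
    ⟨_, .turn p v _ t i arc rest hray hfr htan harc hrest⟩⟩

/-- Induction on the number of hole vertices farther from `s` than the current point, which drops at
every turn. -/
theorem exists_greedyFrom {V : Fin h → Finset Plane}
    (hV : ∀ i, P.hole i = convexHull ℝ (V i : Set Plane)) {s p : Plane} (hp : p ∈ P.carrier)
    (hps : p ≠ s) : ∃ l, IsGreedyFrom P s p (p - s) l := by
  induction hn : ((Finset.univ.biUnion V).filter fun x => ‖p - s‖ < ‖x - s‖).card
    using Nat.strong_induction_on generalizing p with
  | _ n ih =>
    rcases exit_or_turn hV hp (sub_ne_zero.2 hps) (.inr rfl) with hl | ⟨i, t, ht, hlt, htD, hrest⟩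
    · exact hl
    · have hts : t ≠ s := by
        rintro rfl
        rw [sub_self, norm_zero] at hlt
        exact (norm_nonneg _).not_gt hlt
      have htV : t ∈ Finset.univ.biUnion V := Finset.mem_biUnion.2 ⟨i, Finset.mem_univ _, ht⟩
      obtain ⟨l, hl⟩ := ih _ (by
        rw [← hn]
        refine Finset.card_lt_card ⟨fun x hx => ?_, fun hsub => ?_⟩
        · rw [Finset.mem_filter] at hx ⊢
          exact ⟨hx.1, hlt.trans hx.2⟩
        · have := hsub (Finset.mem_filter.2 ⟨htV, hlt⟩)
          exact lt_irrefl _ (Finset.mem_filter.1 this).2) htD hts rfl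
      exact hrest l hl

theorem exists_greedyPath {s u : Plane} (hs : s ∈ P.carrier) (hu : u ≠ 0) :
    ∃ l, IsGreedyPath P s u l := by
  choose V hV using fun i => (P.hole_polygon i).1
  rcases exit_or_turn hV hs hu (.inl rfl) with hl | ⟨i, t, -, hlt, htD, hrest⟩
  · exact hl
  · have hts : t ≠ s := by
      rintro rfl
      exact lt_irrefl _ hlt
    obtain ⟨l, hl⟩ := exists_greedyFrom hV htD hts
    exact hrest l hl

/-! ### The lower bound: chains of triangles -/

/-- A sequence of triangles `a k`, `b k`, `c k` in consecutive annuli around the origin, such that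
a greedy path from the origin that meets the side from `a k` to `b k` leaves it at `b k` and then
meets the side from `a (k + 1)` to `b (k + 1)`. -/
structure IsTriangleChain (a b c : ℕ → Plane) (σ : ℕ → ℝ) : Prop where
  -- These two conditions make `a k` the unique point of the triangle closest to the origin, so an
  -- arc with increasing distance must lead to `b k`.
  out_right : ∀ k, 0 ≤ dot (a k) (b k - a k)
  out_back : ∀ k, 0 ≤ dot (a k) (c k - a k)
  right_lt : ∀ k, dot (b k) (b k) < dot (a (k + 1)) (a (k + 1))
  back_lt : ∀ k, dot (c k) (c k) < dot (a (k + 1)) (a (k + 1))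
  turn : ∀ k, 0 < σ k * cross (a k) (b k)
  left_back : ∀ k, 0 < σ k * cross (a k) (c k)
  back_right : ∀ k, 0 < σ k * cross (c k) (b k)
  beyond : ∀ k, σ k * cross (b k - a k) (c k - a k) < 0
  -- The ray through `b k` passes strictly between `a (k + 1)` and `b (k + 1)`.
  link_left : ∀ k, 0 < σ (k + 1) * cross (a (k + 1)) (b k)
  link_right : ∀ k, 0 < σ (k + 1) * cross (b k) (b (k + 1))

/-- The filled triangle. -/
abbrev triangle (a b c : Plane) : Set Plane := convexHull ℝ {a, b, c}

theorem isConvexPolygon_triangle {a b c : Plane} (h : cross (b - a) (c - a) ≠ 0) :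
    IsConvexPolygon (triangle a b c) := by
  classical
  refine ⟨⟨{a, b, c}, by simp⟩, _, combo_mem_interior h (α := 1 / 3) (β := 1 / 3) (γ := 1 / 3)
    (by norm_num) (by norm_num) (by norm_num) (by norm_num)⟩

theorem pathLength_nonneg : ∀ l : List Plane, 0 ≤ pathLength l
  | [] => le_rfl
  | [_] => le_rfl
  | _ :: b :: l => add_nonneg dist_nonneg (pathLength_nonneg (b :: l))

/-- Needed when `h` is small and the chain is too short to force crossings. -/
theorem _root_.IsGreedyFrom.exists_exit {s p v : Plane} {l : List Plane}
    (hl : IsGreedyFrom P s p v l) : ∃ q ∈ frontier P.outer, dist p q ≤ pathLength l := by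
  induction hl with
  | exit p v q ray hit => exact ⟨q, hit, by simp [pathLength]⟩
  | turn p v q t i arc rest ray hit tangent along next ih =>
    obtain ⟨x, hx, hle⟩ := ih
    refine ⟨x, hx, ?_⟩
    rw [along.pathLength_cons, along.pathLength_append next.head?_eq]
    have := along.dist_le_pathLength
    linarith [dist_triangle p q x, dist_triangle q t x]

/-- A ray cannot pass a point where it enters the interior of a hole. -/
theorem exists_smul_of_reachesAlongRay {i : Fin h} {w q : Plane} {ω μ ν : ℝ}
    (hω : ∀ᶠ r in 𝓝[>] ω, r • w ∈ interior (P.hole i)) (hμ : μ ≤ ω) (hν : 0 < ν)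
    (ray : ReachesAlongRay P.carrier (μ • w) (ν • w) q) : ∃ ρ, μ ≤ ρ ∧ ρ ≤ ω ∧ q = ρ • w := by
  obtain ⟨t, ht, rfl, hseg, -⟩ := ray
  have hnt : 0 ≤ t * ν := by positivity
  have e : μ • w + t • ν • w = (μ + t * ν) • w := by module
  refine ⟨μ + t * ν, by linarith, ?_, e⟩
  by_contra! hlt
  obtain ⟨r, hr, hr1, hr2⟩ := (hω.and (Ioo_mem_nhdsGT hlt)).exists
  have hpos : 0 < t * ν := by linarith
  have hmem : r • w ∈ segment ℝ (μ • w) (μ • w + t • ν • w) := by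
    refine ⟨1 - (r - μ) / (t * ν), (r - μ) / (t * ν), ?_, div_nonneg (by linarith) hpos.le,
      by ring, ?_⟩
    · rw [sub_nonneg, div_le_one hpos]; linarith
    · rw [e]
      have : (1 - (r - μ) / (t * ν)) • μ • w + ((r - μ) / (t * ν)) • (μ + t * ν) • w =
          (μ + (r - μ) / (t * ν) * (t * ν)) • w := by module
      rw [this, div_mul_cancel₀ _ hpos.ne']
      congr 1
      ring
  exact (hseg hmem).2 (Set.mem_iUnion.2 ⟨i, hr⟩)

/-- A ray from the origin in a direction between `a` and `b` enters the triangle `a b c` through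
the side from `a` to `b`. -/
theorem exists_entry {a b c w : Plane} {σ : ℝ} (hσ : 0 < σ * cross a b)
    (hD : σ * cross (b - a) (c - a) < 0) (haw : 0 < σ * cross a w) (hwb : 0 < σ * cross w b) :
    ∃ ω : ℝ, 0 < ω ∧ ω • w ∈ triangle a b c ∧
      ∀ᶠ r in 𝓝[>] ω, r • w ∈ interior (triangle a b c) := by
  have hσ0 : σ ≠ 0 := by rintro rfl; simp at hσ
  set S := σ * cross a w + σ * cross w b with hS
  have hS0 : 0 < S := by positivity
  set D := cross (b - a) (c - a) with hDdef
  have hD0 : D ≠ 0 := by intro h0; simp [h0] at hD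
  have hω : (σ * cross a b / S) • w = (σ * cross w b / S) • a + (σ * cross a w / S) • b := by
    apply plane_ext <;>
    · simp only [PiLp.add_apply, PiLp.smul_apply, smul_eq_mul]
      field_simp
      simp only [cross]
      ring
  set ω := σ * cross a b / S with hωdef
  have hω0 : 0 < ω := by positivity
  have hsum : σ * cross w b / S + σ * cross a w / S = 1 := by
    field_simp; rw [hS]; ring
  refine ⟨ω, hω0, ?_, ?_⟩
  · have := combo_mem_convexHull a b c (α := σ * cross w b / S) (β := σ * cross a w / S) (γ := 0)
      (by positivity) (by positivity) le_rfl (by rw [add_zero]; exact hsum)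
    rwa [zero_smul, add_zero, ← hω] at this
  · have hc1 : Continuous fun r : ℝ => cross (b - r • w) (c - r • w) / D :=
      (continuous_cross (by fun_prop) (by fun_prop)).div_const _
    have hc2 : Continuous fun r : ℝ => cross (c - r • w) (a - r • w) / D :=
      (continuous_cross (by fun_prop) (by fun_prop)).div_const _
    have v1 : cross (b - ω • w) (c - ω • w) / D = σ * cross w b / S := by
      rw [div_eq_iff hD0, hω]
      have : σ * cross a w / S = 1 - σ * cross w b / S := by linarith
      rw [this]
      simp only [hDdef, cross, PiLp.sub_apply, PiLp.add_apply, PiLp.smul_apply, smul_eq_mul]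
      ring
    have v2 : cross (c - ω • w) (a - ω • w) / D = σ * cross a w / S := by
      rw [div_eq_iff hD0, hω]
      have : σ * cross w b / S = 1 - σ * cross a w / S := by linarith
      rw [this]
      simp only [hDdef, cross, PiLp.sub_apply, PiLp.add_apply, PiLp.smul_apply, smul_eq_mul]
      ring
    have e1 : ∀ᶠ r in 𝓝[>] ω, 0 < cross (b - r • w) (c - r • w) / D :=
      ((hc1.tendsto ω).mono_left nhdsWithin_le_nhds).eventually
        (lt_mem_nhds (by rw [v1]; positivity))
    have e2 : ∀ᶠ r in 𝓝[>] ω, 0 < cross (c - r • w) (a - r • w) / D :=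
      ((hc2.tendsto ω).mono_left nhdsWithin_le_nhds).eventually
        (lt_mem_nhds (by rw [v2]; positivity))
    filter_upwards [e1, e2, self_mem_nhdsWithin] with r h1 h2 hr
    have h3 : 0 < cross (a - r • w) (b - r • w) / D := by
      have : cross (a - r • w) (b - r • w) / D = σ * cross (a - r • w) (b - r • w) / (σ * D) := by
        rw [mul_div_mul_left _ _ hσ0]
      rw [this]
      refine div_pos_of_neg_of_neg ?_ hD
      have : σ * cross (a - r • w) (b - r • w) = S * (ω - r) := by
        rw [mul_sub, hωdef, mul_div_cancel₀ _ hS0.ne', hS]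
        simp only [cross, PiLp.sub_apply, PiLp.smul_apply, smul_eq_mul]
        ring
      rw [this]
      exact mul_neg_of_pos_of_neg hS0 (sub_neg.2 hr)
    have hs : cross (b - r • w) (c - r • w) / D + cross (c - r • w) (a - r • w) / D +
        cross (a - r • w) (b - r • w) / D = 1 := by
      field_simp
      simp only [hDdef, cross, PiLp.sub_apply, PiLp.smul_apply, smul_eq_mul]
      ring
    convert combo_mem_interior hD0 h1 h2 h3 hs using 1
    apply plane_ext <;>
    · simp only [PiLp.add_apply, PiLp.smul_apply, smul_eq_mul]
      field_simp
      simp only [hDdef, cross, PiLp.sub_apply, PiLp.smul_apply, smul_eq_mul]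
      ring

/-- Seen from the origin, `c` is strictly between `a` and `b`. A tangent has `a` and `b` weakly on
one side, while any point of the triangle has them weakly on opposite sides, so one of the cross
products vanishes. -/
theorem eq_or_eq_of_tangent {a b c t : Plane} {σ : ℝ} (hσ : 0 < σ * cross a b)
    (hac : 0 < σ * cross a c) (hcb : 0 < σ * cross c b)
    (ht : IsLeftTangentPoint 0 (triangle a b c) t ∨ IsRightTangentPoint 0 (triangle a b c) t) :
    t = a ∨ t = b := by
  have ha : a ∈ triangle a b c := subset_convexHull ℝ _ (by simp)
  have hb : b ∈ triangle a b c := subset_convexHull ℝ _ (by simp)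
  have htm : t ∈ triangle a b c := by rcases ht with h | h <;> exact h.1
  have hprod : 0 ≤ cross t a * cross t b := by
    rcases ht with ⟨-, -, h⟩ | ⟨-, -, h⟩
    · have h1 := h a ha
      have h2 := h b hb
      rw [sub_zero, sub_zero] at h1 h2
      positivity
    · have h1 := h a ha
      have h2 := h b hb
      rw [sub_zero, sub_zero] at h1 h2
      exact mul_nonneg_of_nonpos_of_nonpos h1 h2
  obtain ⟨α, β, γ, hα, hβ, hγ, hs, rfl⟩ := exists_combo_of_mem_convexHull htm
  have e1 : cross (α • a + β • b + γ • c) a = -(β * cross a b + γ * cross a c) := by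
    simp only [cross, PiLp.add_apply, PiLp.smul_apply, smul_eq_mul]; ring
  have e2 : cross (α • a + β • b + γ • c) b = α * cross a b + γ * cross c b := by
    simp only [cross, PiLp.add_apply, PiLp.smul_apply, smul_eq_mul]; ring
  rw [e1, e2] at hprod
  have p1 : 0 ≤ β * (σ * cross a b) + γ * (σ * cross a c) := by positivity
  have p2 : 0 ≤ α * (σ * cross a b) + γ * (σ * cross c b) := by positivity
  have hz : (β * (σ * cross a b) + γ * (σ * cross a c)) *
      (α * (σ * cross a b) + γ * (σ * cross c b)) = 0 := by
    apply le_antisymm _ (mul_nonneg p1 p2)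
    nlinarith [mul_nonneg (sq_nonneg σ) hprod]
  rcases mul_eq_zero.1 hz with h0 | h0
  · have z1 := (add_eq_zero_iff_of_nonneg (by positivity) (by positivity)).1 h0
    have hβ0 : β = 0 := (mul_eq_zero.1 z1.1).resolve_right hσ.ne'
    have hγ0 : γ = 0 := (mul_eq_zero.1 z1.2).resolve_right hac.ne'
    have hα1 : α = 1 := by linarith
    left; simp [hβ0, hγ0, hα1]
  · have z1 := (add_eq_zero_iff_of_nonneg (by positivity) (by positivity)).1 h0
    have hα0 : α = 0 := (mul_eq_zero.1 z1.1).resolve_right hσ.ne'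
    have hγ0 : γ = 0 := (mul_eq_zero.1 z1.2).resolve_right hcb.ne'
    have hβ1 : β = 1 := by linarith
    right; simp [hα0, hγ0, hβ1]

namespace IsTriangleChain

variable {a b c : ℕ → Plane} {σ : ℕ → ℝ}

theorem left_ne_zero (C : IsTriangleChain a b c σ) (k : ℕ) : a k ≠ 0 := by
  intro h0
  have := C.turn k
  simp [h0, cross] at this

theorem dot_nonneg (C : IsTriangleChain a b c σ) {k : ℕ} {x : Plane}
    (hx : x ∈ triangle (a k) (b k) (c k)) : 0 ≤ dot (a k) (x - a k) := by
  obtain ⟨α, β, γ, hα, hβ, hγ, hs, rfl⟩ := exists_combo_of_mem_convexHull hx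
  have : dot (a k) (α • a k + β • b k + γ • c k - a k) =
      β * dot (a k) (b k - a k) + γ * dot (a k) (c k - a k) := by
    have hα' : α = 1 - β - γ := by linarith
    subst hα'
    simp only [dot, PiLp.sub_apply, PiLp.add_apply, PiLp.smul_apply, smul_eq_mul]
    ring
  rw [this]
  exact add_nonneg (mul_nonneg hβ (C.out_right k)) (mul_nonneg hγ (C.out_back k))

theorem eq_left_of_norm_le (C : IsTriangleChain a b c σ) {k : ℕ} {x : Plane}
    (hx : x ∈ triangle (a k) (b k) (c k)) (hn : ‖x‖ ≤ ‖a k‖) : x = a k := by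
  have h1 := C.dot_nonneg hx
  rw [norm_le_norm_iff_dot] at hn
  by_contra hne
  have h2 := dot_self_pos (sub_ne_zero.2 hne)
  simp only [dot, PiLp.sub_apply] at *
  nlinarith

theorem norm_left_le (C : IsTriangleChain a b c σ) {k : ℕ} {x : Plane}
    (hx : x ∈ triangle (a k) (b k) (c k)) : ‖a k‖ ≤ ‖x‖ := by
  by_contra! hlt
  rw [C.eq_left_of_norm_le hx hlt.le] at hlt
  exact lt_irrefl _ hlt

theorem norm_right_lt (C : IsTriangleChain a b c σ) (k : ℕ) : ‖b k‖ < ‖a (k + 1)‖ :=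
  (norm_lt_norm_iff_dot _ _).2 (C.right_lt k)

theorem right_mem (a b c : ℕ → Plane) (k : ℕ) : b k ∈ triangle (a k) (b k) (c k) :=
  subset_convexHull ℝ _ (by simp)

theorem norm_left_strictMono (C : IsTriangleChain a b c σ) : StrictMono fun k => ‖a k‖ :=
  strictMono_nat_of_lt_succ fun k =>
    (C.norm_left_le (right_mem a b c k)).trans_lt (C.norm_right_lt k)

theorem norm_lt (C : IsTriangleChain a b c σ) {k : ℕ} {x : Plane}
    (hx : x ∈ triangle (a k) (b k) (c k)) : ‖x‖ < ‖a (k + 1)‖ := by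
  have hsub : triangle (a k) (b k) (c k) ⊆ Metric.ball 0 ‖a (k + 1)‖ := by
    refine convexHull_min ?_ (convex_ball _ _)
    rintro y (rfl | rfl | rfl) <;> rw [mem_ball_zero_iff]
    · exact C.norm_left_strictMono k.lt_succ_self
    · exact C.norm_right_lt k
    · exact (norm_lt_norm_iff_dot _ _).2 (C.back_lt k)
  exact mem_ball_zero_iff.1 (hsub hx)

theorem disjoint (C : IsTriangleChain a b c σ) {j k : ℕ} (hjk : j ≠ k) :
    Disjoint (triangle (a j) (b j) (c j)) (triangle (a k) (b k) (c k)) := by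
  wlog hlt : j < k generalizing j k
  · exact (this hjk.symm (by omega)).symm
  · refine Set.disjoint_left.2 fun x hx hx' => ?_
    exact ((C.norm_lt hx).trans_le (C.norm_left_strictMono.monotone (Nat.succ_le_of_lt hlt))).not_ge
      (C.norm_left_le hx')

theorem isConvexPolygon (C : IsTriangleChain a b c σ) (k : ℕ) :
    IsConvexPolygon (triangle (a k) (b k) (c k)) :=
  isConvexPolygon_triangle fun h0 => by
    have := C.beyond k
    simp [h0] at this

theorem eq_right_of_mem (C : IsTriangleChain a b c σ) {k : ℕ} {ρ : ℝ}
    (hx : ρ • b k ∈ triangle (a k) (b k) (c k)) : ρ • b k = b k := by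
  obtain ⟨α, β, γ, hα, hβ, hγ, hs, h⟩ := exists_combo_of_mem_convexHull hx
  have h1 := C.turn k
  have h2 := C.back_right k
  have h0 : α * (σ k * cross (a k) (b k)) + γ * (σ k * cross (c k) (b k)) = 0 := by
    have e : cross (ρ • b k) (b k) = 0 := by
      simp only [cross, PiLp.smul_apply, smul_eq_mul]; ring
    rw [h] at e
    simp only [cross, PiLp.add_apply, PiLp.smul_apply, smul_eq_mul] at e ⊢
    linear_combination σ k * e
  have z1 := (add_eq_zero_iff_of_nonneg (by positivity) (by positivity)).1 h0
  have hα0 : α = 0 := (mul_eq_zero.1 z1.1).resolve_right h1.ne'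
  have hγ0 : γ = 0 := (mul_eq_zero.1 z1.2).resolve_right h2.ne'
  have hβ1 : β = 1 := by linarith
  rw [h, hα0, hγ0, hβ1]
  simp

/-- The end of an arc along one of the triangles. -/
theorem arc_end (C : IsTriangleChain a b c σ)
    (hP : ∀ i : Fin h, P.hole i = triangle (a i) (b i) (c i))
    {i : Fin h} {q t : Plane} {arc : List Plane} (hq : q ∈ P.hole i)
    (ht : IsLeftTangentPoint 0 (P.hole i) t ∨ IsRightTangentPoint 0 (P.hole i) t)
    (along : IsBoundaryArc 0 (P.hole i) q t arc) : t = b i ∨ t = a i ∧ q = a i := by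
  rw [hP i] at ht
  rcases eq_or_eq_of_tangent (C.turn i) (C.left_back i) (C.back_right i) ht with h | h
  · right
    -- The distance does not decrease along the arc, so an arc that ends at the closest point starts
    -- there.
    refine ⟨h, C.eq_left_of_norm_le (by rwa [hP i] at hq) ?_⟩
    have := along.norm_le
    rwa [sub_zero, sub_zero, h] at this
  · exact .inl h

/-- The ray through `b k` cannot get past triangle `k + 1`, and the annuli leave only triangles `k`
and `k + 1` as the hole it stops at. The point `ρ • b k` is where it stops. -/
theorem exists_next_right (C : IsTriangleChain a b c σ)
    (hP : ∀ i : Fin h, P.hole i = triangle (a i) (b i) (c i))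
    (hout : ∀ x, ‖x‖ ≤ ‖a h‖ → x ∈ interior P.outer) {k : ℕ} (hk : k + 1 < h) {l : List Plane}
    (hl : IsGreedyFrom P 0 (b k) (b k - 0) l) : ∃ ρ : ℝ, 1 ≤ ρ ∧ ∃ l',
      IsGreedyFrom P 0 (b (k + 1)) (b (k + 1) - 0) l' ∧
        dist (ρ • b k) (b (k + 1)) + pathLength l' ≤ pathLength l := by
  obtain ⟨ω, hω0, hωmem, hω⟩ := exists_entry (C.turn (k + 1)) (C.beyond (k + 1)) (C.link_left k)
    (C.link_right k)
  have hb0 : 0 < ‖b k‖ :=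
    (norm_pos_iff.2 (C.left_ne_zero k)).trans_le (C.norm_left_le (right_mem a b c k))
  have hω1 : 1 ≤ ω := by
    have h1 := (C.norm_right_lt k).trans_le (C.norm_left_le hωmem)
    rw [norm_smul, Real.norm_of_nonneg hω0.le] at h1
    by_contra! hlt
    nlinarith
  have hωi : ∀ᶠ r in 𝓝[>] ω, r • b k ∈ interior (P.hole ⟨k + 1, hk⟩) := by rwa [hP]
  have hreach : ∀ q, ReachesAlongRay P.carrier (b k) (b k - 0) q →
      ∃ ρ : ℝ, 1 ≤ ρ ∧ q = ρ • b k ∧ ‖q‖ < ‖a (k + 2)‖ := by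
    intro q hq
    have hq' : ReachesAlongRay P.carrier ((1 : ℝ) • b k) ((1 : ℝ) • b k) q := by
      rw [one_smul]
      rwa [sub_zero] at hq
    obtain ⟨ρ, hρ1, hρω, rfl⟩ := exists_smul_of_reachesAlongRay hωi hω1 one_pos hq'
    refine ⟨ρ, hρ1, rfl, lt_of_le_of_lt ?_ (C.norm_lt hωmem)⟩
    rw [norm_smul, norm_smul, Real.norm_of_nonneg (by linarith), Real.norm_of_nonneg hω0.le]
    gcongr
  generalize hp : b k = p at hl
  generalize hv : b k - 0 = v at hl
  have hv' : p - 0 = v := by rw [← hp, hv]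
  rw [hv'] at hl
  cases hl with
  | exit _ _ q ray hit =>
    subst hp hv
    obtain ⟨ρ, hρ, rfl, hlt⟩ := hreach q ray
    exact absurd (hout _ (hlt.le.trans (C.norm_left_strictMono.monotone hk))) hit.2
  | turn _ _ q t i arc rest ray hit tangent along next =>
    subst hp hv
    obtain ⟨ρ, hρ, rfl, hlt⟩ := hreach q ray
    have hqi := (P.hole_polygon i).isClosed.frontier_subset hit
    have hqi' := hqi
    rw [hP i] at hqi'
    have hge : ‖b k‖ ≤ ‖ρ • b k‖ := by
      rw [norm_smul, Real.norm_of_nonneg (by linarith)]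
      nlinarith
    have hi2 : (i : ℕ) < k + 2 := by
      rw [← C.norm_left_strictMono.lt_iff_lt]
      exact (C.norm_left_le hqi').trans_lt hlt
    have hi1 : k < i + 1 := by
      rw [← C.norm_left_strictMono.lt_iff_lt]
      exact ((C.norm_left_le (right_mem a b c k)).trans hge).trans_lt (C.norm_lt hqi')
    obtain hik | hik : (i : ℕ) = k ∨ (i : ℕ) = k + 1 := by omega
    -- Stopping again at `b k` would require the ray to leave the domain at once, but up to distance
    -- `‖a (k + 1)‖` it is free.
    · exfalso
      rw [hik] at hqi'
      have heq := C.eq_right_of_mem hqi'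
      obtain ⟨τ, hτ, hτq, -, hleave⟩ := ray
      rw [heq, sub_zero, left_eq_add, smul_eq_zero] at hτq
      have hτ0 := hτq.resolve_right (norm_pos_iff.1 hb0)
      have hε : 0 < (‖a (k + 1)‖ - ‖b k‖) / ‖b k‖ := div_pos (sub_pos.2 (C.norm_right_lt k)) hb0
      obtain ⟨r, hr0, hr, hD⟩ := hleave hτ0 _ hε
      have hx : b k + r • (b k - 0) = (1 + r) • b k := by rw [sub_zero]; module
      rw [hx] at hD
      have hn : ‖(1 + r) • b k‖ = ‖b k‖ + r * ‖b k‖ := by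
        rw [norm_smul, Real.norm_of_nonneg (by linarith)]; ring
      rw [lt_div_iff₀ hb0] at hr
      have hup : ‖(1 + r) • b k‖ < ‖a (k + 1)‖ := by linarith
      have hlo : ‖b k‖ < ‖(1 + r) • b k‖ := by
        rw [hn]; linarith [mul_pos hr0 hb0]
      refine hD ⟨interior_subset (hout _ (hup.le.trans
        (C.norm_left_strictMono.monotone hk.le))), fun hU => ?_⟩
      obtain ⟨j, hj⟩ := Set.mem_iUnion.1 hU
      have hj' := interior_subset hj
      rw [hP j] at hj'
      have h1 : (j : ℕ) < k + 1 := by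
        rw [← C.norm_left_strictMono.lt_iff_lt]
        exact (C.norm_left_le hj').trans_lt hup
      have h2 : k < j + 1 := by
        rw [← C.norm_left_strictMono.lt_iff_lt]
        exact ((C.norm_left_le (right_mem a b c k)).trans_lt hlo).trans (C.norm_lt hj')
      have hjk : (j : ℕ) = k := by omega
      rw [hjk] at hj'
      rw [C.eq_right_of_mem hj'] at hlo
      exact lt_irrefl _ hlo
    · have hne : ρ • b k ≠ a i := by
        intro heq
        have h1 := C.link_left k
        rw [← hik, ← heq] at h1
        have e : cross (ρ • b k) (b k) = 0 := by
          simp only [cross, PiLp.smul_apply, smul_eq_mul]; ring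
        rw [e, mul_zero] at h1
        exact lt_irrefl _ h1
      obtain rfl : t = b i := (C.arc_end hP hqi tangent along).resolve_right fun hh => hne hh.2
      rw [hik] at next along
      refine ⟨ρ, hρ, rest, next, ?_⟩
      rw [along.pathLength_cons, along.pathLength_append next.head?_eq]
      linarith [along.dist_le_pathLength, dist_nonneg (x := b k) (y := ρ • b k)]

/-- A greedy path in a direction between `a k` and `b k` passes one of the vertices
`b 0, …, b k`. -/
theorem exists_first_right (C : IsTriangleChain a b c σ)
    (hP : ∀ i : Fin h, P.hole i = triangle (a i) (b i) (c i))
    (hout : ∀ x, ‖x‖ ≤ ‖a h‖ → x ∈ interior P.outer) {k : ℕ} (hk : k < h) {w : Plane} (haw : 0 < σ k * cross (a k) w)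
    (hwb : 0 < σ k * cross w (b k)) {l : List Plane} (hl : IsGreedyPath P 0 w l) :
    ∃ i ≤ k, ∃ l', IsGreedyFrom P 0 (b i) (b i - 0) l' ∧ pathLength l' ≤ pathLength l := by
  obtain ⟨ω, hω0, hωmem, hω⟩ := exists_entry (C.turn k) (C.beyond k) haw hwb
  have hωi : ∀ᶠ r in 𝓝[>] ω, r • w ∈ interior (P.hole ⟨k, hk⟩) := by rwa [hP]
  -- A touch at some `a i` keeps the path on the same ray, but changes its starting point and the
  -- length of its direction vector; hence the general `μ` and `ν`.
  suffices H : ∀ s p v l, IsGreedyFrom P s p v l → s = 0 → ∀ μ ν : ℝ, 0 ≤ μ → μ ≤ ω → 0 < ν →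
      p = μ • w → v = ν • w →
      ∃ i ≤ k, ∃ l', IsGreedyFrom P 0 (b i) (b i - 0) l' ∧ pathLength l' ≤ pathLength l from
    H 0 0 w l hl rfl 0 1 le_rfl hω0.le one_pos (by simp) (by simp)
  intro s p v l hl
  induction hl with
  | exit p v q ray hit =>
    rintro rfl μ ν hμ0 hμ hν rfl rfl
    obtain ⟨ρ, hρ1, hρω, rfl⟩ := exists_smul_of_reachesAlongRay hωi hμ hν ray
    refine absurd (hout _ ?_) hit.2
    refine le_trans ?_ ((C.norm_lt hωmem).le.trans (C.norm_left_strictMono.monotone hk))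
    rw [norm_smul, norm_smul, Real.norm_of_nonneg (by linarith), Real.norm_of_nonneg hω0.le]
    gcongr
  | turn p v q t i arc rest ray hit tangent along next ih =>
    rintro rfl μ ν hμ0 hμ hν rfl rfl
    obtain ⟨ρ, hρ1, hρω, rfl⟩ := exists_smul_of_reachesAlongRay hωi hμ hν ray
    have hqi := (P.hole_polygon i).isClosed.frontier_subset hit
    have hqi' := hqi
    rw [hP i] at hqi'
    have hnorm : ‖ρ • w‖ ≤ ‖ω • w‖ := by
      rw [norm_smul, norm_smul, Real.norm_of_nonneg (by linarith), Real.norm_of_nonneg hω0.le]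
      gcongr
    have hik : (i : ℕ) < k + 1 := by
      rw [← C.norm_left_strictMono.lt_iff_lt]
      exact ((C.norm_left_le hqi').trans hnorm).trans_lt (C.norm_lt hωmem)
    have hle : pathLength rest ≤ pathLength (μ • w :: (arc ++ rest)) := by
      rw [along.pathLength_cons, along.pathLength_append next.head?_eq]
      linarith [pathLength_nonneg arc, dist_nonneg (x := μ • w) (y := ρ • w)]
    rcases C.arc_end hP hqi tangent along with rfl | ⟨hta, hqa⟩
    · exact ⟨i, by omega, rest, next, hle⟩
    · have hρ0 : 0 < ρ := by
        refine lt_of_le_of_ne (hμ0.trans hρ1) fun h0 => C.left_ne_zero i ?_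
        rw [← hqa, ← h0, zero_smul]
      have htq : t = ρ • w := by rw [hta, hqa]
      obtain ⟨j, hj, l', hl', hle'⟩ := ih rfl ρ ρ hρ0.le hρω hρ0 htq (by rw [sub_zero, htq])
      exact ⟨j, hj, l', hl', hle'.trans hle⟩

/-- If every passage from one triangle to the next has length at least `d` from the index `m` on,
a greedy path that passes `b k` has length at least `d` per remaining triangle. -/
theorem mul_le_pathLength (C : IsTriangleChain a b c σ)
    (hP : ∀ i : Fin h, P.hole i = triangle (a i) (b i) (c i))
    (hout : ∀ x, ‖x‖ ≤ ‖a h‖ → x ∈ interior P.outer) {d : ℝ} (hd : 0 ≤ d) {m : ℕ}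
    (hdist : ∀ k, m ≤ k + 1 → ∀ ρ : ℝ, 1 ≤ ρ → d ≤ dist (ρ • b k) (b (k + 1))) {k : ℕ}
    (hk : k < h) {l : List Plane} (hl : IsGreedyFrom P 0 (b k) (b k - 0) l) :
    d * ((h : ℝ) - (max (k + 1) m : ℕ)) ≤ pathLength l := by
  induction hn : h - 1 - k generalizing k l with
  | zero =>
    refine le_trans (mul_nonpos_of_nonneg_of_nonpos hd ?_) (pathLength_nonneg l)
    rw [sub_nonpos]
    exact_mod_cast (show h ≤ max (k + 1) m by omega)
  | succ n ih =>
    obtain ⟨ρ, hρ, l', hl', hle⟩ := C.exists_next_right hP hout (by omega) hl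
    have h1 := ih (by omega) hl' (by omega)
    rcases le_or_gt m (k + 1) with hm | hm
    · have h2 := hdist k hm ρ hρ
      rw [max_eq_left (by omega)] at h1 ⊢
      push_cast at h1 ⊢
      linarith
    · rw [max_eq_right (by omega)] at h1 ⊢
      linarith [dist_nonneg (x := ρ • b k) (y := b (k + 1))]

end IsTriangleChain

/-! ### The lower bound: the spiral and the zigzag -/

/-- The left ends of the triangles: five of them wind once around the origin, and the
others form a zigzag along the first coordinate axis. -/
noncomputable def leftEnd (h : ℕ) : ℕ → Plane
  -- By `out_right` a front side spans less than a right angle, so four triangles cannot cover all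
  -- directions. With five, the distances grow by a factor of about 4.5 each.
  | 0 => !₂[12, -1]
  | 1 => !₂[21, 50]
  | 2 => !₂[-186, 161]
  | 3 => !₂[-956, -575]
  | 4 => !₂[1138, -4929]
  -- At distance at least `30000 * h` an advance of 1 gains more in squared distance than a crossing
  -- of height `3 * √h` needs. The left ends are twice as high as the right ends, so that the ray
  -- through a right end meets the next front side.
  | j + 5 => !₂[30000 * h + 2 * j, 2 * ((-1) ^ j * √(h : ℝ))]

/-- The right ends of the triangles. -/
noncomputable def rightEnd (h : ℕ) : ℕ → Plane
  | 0 => !₂[17, 51]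
  | 1 => !₂[-195, 142]
  | 2 => !₂[-885, -643]
  | 3 => !₂[1533, -4717]
  | 4 => !₂[22488, 0]
  | j + 5 => !₂[30000 * h + 2 * j + 1, -((-1) ^ j * √(h : ℝ))]

/-- The vertices of the triangles that are hidden from the origin. -/
noncomputable def backEnd (h : ℕ) : ℕ → Plane
  | 0 => !₂[16, 28]
  | 1 => !₂[-96, 106]
  | 2 => !₂[-589, -265]
  | 3 => !₂[317, -2911]
  | 4 => !₂[12994, -2711]
  | j + 5 => !₂[30000 * h + 2 * j + 1, 0]

/-- The orientations of the triangles. -/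
noncomputable def orientation : ℕ → ℝ
  | 0 => 1
  | 1 => 1
  | 2 => 1
  | 3 => 1
  | 4 => 1
  | j + 5 => -(-1) ^ j

theorem isTriangleChain {h : ℕ} (hh : 1 ≤ h) :
    IsTriangleChain (leftEnd h) (rightEnd h) (backEnd h) orientation := by
  have h1 : (1 : ℝ) ≤ h := by exact_mod_cast hh
  obtain ⟨r, hr, hr0, hrh⟩ : ∃ r : ℝ, √(h : ℝ) = r ∧ 0 < r ∧ r ^ 2 = h :=
    ⟨_, rfl, Real.sqrt_pos.2 (by linarith), Real.sq_sqrt (by linarith)⟩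
  have hrh' : 0 < r * h := by positivity
  have hhh : (1 : ℝ) ≤ h * h := by nlinarith
  constructor <;> rintro (_ | _ | _ | _ | _ | j) <;>
    simp only [leftEnd, rightEnd, backEnd, orientation, dot, cross, PiLp.sub_apply,
      Matrix.cons_val_zero, Matrix.cons_val_one, hr] <;>
    norm_num <;> try nlinarith
  all_goals
    have hrj : 0 ≤ r * j := by positivity
    have hhj : (0 : ℝ) ≤ h * j := by positivity
    rcases neg_one_pow_eq_or ℝ j with e | e <;> simp only [pow_succ, e] <;> nlinarith

/-- Only heights are compared. Consecutive right ends of the zigzag are on opposite sides of the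
axis at height `√h`, and `ρ ≥ 1` can only increase the difference; `rightEnd h 4` is on the axis, so
the first crossing counts as well. -/
theorem sqrt_le_dist (h : ℕ) {k : ℕ} (hk : 5 ≤ k + 1) {ρ : ℝ} (hρ : 1 ≤ ρ) :
    √(h : ℝ) ≤ dist (ρ • rightEnd h k) (rightEnd h (k + 1)) := by
  have hr : 0 ≤ √(h : ℝ) := Real.sqrt_nonneg _
  refine le_trans ?_ (PiLp.dist_apply_le (p := 2) _ _ 1)
  rw [Real.dist_eq]
  obtain ⟨j, rfl⟩ := Nat.exists_eq_add_of_le' (show 4 ≤ k by omega)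
  rcases j with _ | j
  · simp only [rightEnd, PiLp.smul_apply, smul_eq_mul, Matrix.cons_val_one, Matrix.cons_val_zero]
    simp [abs_of_nonneg hr]
  · change _ ≤ |(ρ • rightEnd h (j + 5)) 1 - rightEnd h (j + 1 + 5) 1|
    simp only [rightEnd, PiLp.smul_apply, smul_eq_mul, Matrix.cons_val_one, Matrix.cons_val_zero]
    have : ρ * -((-1) ^ j * √(h : ℝ)) - -((-1) ^ (j + 1) * √(h : ℝ)) =
        -((-1) ^ j) * ((ρ + 1) * √(h : ℝ)) := by ring
    rw [this, abs_mul, abs_neg, abs_pow, abs_neg, abs_one, one_pow, one_mul,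
      abs_of_nonneg (by positivity)]
    nlinarith

theorem norm_leftEnd_le {h : ℕ} (hh : 1 ≤ h) : ‖leftEnd h h‖ ≤ 31000 * h := by
  have h1 : (1 : ℝ) ≤ h := by exact_mod_cast hh
  -- Passing to index `h + 5` lands in the zigzag for every `h`.
  refine ((isTriangleChain hh).norm_left_strictMono.monotone (show h ≤ h + 5 by omega)).trans ?_
  refine le_of_sq_le_sq ?_ (by positivity)
  rw [norm_sq_eq]
  simp only [leftEnd, Matrix.cons_val_zero, Matrix.cons_val_one]
  have e : (2 * ((-1) ^ h * √(h : ℝ))) ^ 2 = 4 * h := by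
    rw [mul_pow, mul_pow, Real.sq_sqrt (by linarith), ← pow_mul, mul_comm h 2, pow_mul]
    norm_num
  rw [e]
  nlinarith

/-- The five first triangles surround the origin. -/
theorem exists_direction (h : ℕ) {u : Plane} (hu : u ≠ 0) : ∃ k < 5,
    0 < orientation k * cross (leftEnd h k) u ∧ 0 < orientation k * cross u (rightEnd h k) := by
  by_contra! hno
  have h0 := hno 0 (by norm_num)
  have h1 := hno 1 (by norm_num)
  have h2 := hno 2 (by norm_num)
  have h3 := hno 3 (by norm_num)
  have h4 := hno 4 (by norm_num)
  simp only [leftEnd, rightEnd, orientation, cross, Matrix.cons_val_zero, Matrix.cons_val_one,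
    one_mul, imp_iff_not_or, not_lt] at h0 h1 h2 h3 h4
  -- Missing each sector on one of its two sides gives five linear inequalities, which contradict
  -- each sign of a nonzero coordinate of `u`.
  refine hu (plane_ext ?_ ?_) <;> rw [PiLp.zero_apply] <;> by_contra hne <;>
    rcases lt_or_gt_of_ne hne with hlt | hlt <;>
    rcases h0 with h0 | h0 <;> rcases h1 with h1 | h1 <;> rcases h2 with h2 | h2 <;>
    rcases h3 with h3 | h3 <;> rcases h4 with h4 | h4 <;> linarith

theorem ball_subset_interior_triangle {R : ℝ} (hR : 0 < R) {x : Plane} (hx : ‖x‖ ≤ R) :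
    x ∈ interior (triangle !₂[-(4 * R), -(2 * R)] !₂[4 * R, -(2 * R)] !₂[0, 4 * R]) := by
  have hsq : x 0 ^ 2 + x 1 ^ 2 ≤ R ^ 2 := by
    rw [← norm_sq_eq]
    exact pow_le_pow_left₀ (norm_nonneg x) hx 2
  have hx0 := abs_le.1 (abs_le_of_sq_le_sq (show x 0 ^ 2 ≤ R ^ 2 by nlinarith [sq_nonneg (x 1)])
    hR.le)
  have hx1 := abs_le.1 (abs_le_of_sq_le_sq (show x 1 ^ 2 ≤ R ^ 2 by nlinarith [sq_nonneg (x 0)])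
    hR.le)
  have hD : cross (!₂[4 * R, -(2 * R)] - !₂[-(4 * R), -(2 * R)])
      (!₂[0, 4 * R] - !₂[-(4 * R), -(2 * R)]) ≠ 0 := by
    simp only [cross, PiLp.sub_apply, Matrix.cons_val_zero, Matrix.cons_val_one]
    have : 0 < R * R := by positivity
    nlinarith
  have hc := combo_mem_interior hD (α := (4 * R - x 1) / (12 * R) - x 0 / (8 * R))
    (β := (4 * R - x 1) / (12 * R) + x 0 / (8 * R)) (γ := (x 1 + 2 * R) / (6 * R))
    (by
      have : (4 * R - x 1) / (12 * R) - x 0 / (8 * R) = (8 * R - 2 * x 1 - 3 * x 0) / (24 * R) := by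
        field_simp; ring
      rw [this]; apply div_pos <;> linarith)
    (by
      have : (4 * R - x 1) / (12 * R) + x 0 / (8 * R) = (8 * R - 2 * x 1 + 3 * x 0) / (24 * R) := by
        field_simp; ring
      rw [this]; apply div_pos <;> linarith)
    (by apply div_pos <;> linarith) (by field_simp; ring)
  convert hc using 1
  apply plane_ext <;>
  · simp only [PiLp.add_apply, PiLp.smul_apply, smul_eq_mul, Matrix.cons_val_zero,
      Matrix.cons_val_one]
    field_simp
    ring

theorem triangle_subset_closedBall {R : ℝ} (hR : 0 < R) :
    triangle !₂[-(4 * R), -(2 * R)] !₂[4 * R, -(2 * R)] !₂[0, 4 * R] ⊆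
      Metric.closedBall 0 (5 * R) := by
  refine convexHull_min ?_ (convex_closedBall _ _)
  rintro y (rfl | rfl | rfl) <;> rw [mem_closedBall_zero_iff] <;>
    refine le_of_sq_le_sq ?_ (by positivity) <;> rw [norm_sq_eq] <;>
    simp only [Matrix.cons_val_zero, Matrix.cons_val_one] <;> nlinarith [sq_nonneg R]

/-- The domain whose holes are the first `h` triangles. -/
noncomputable def spiralZigzag {h : ℕ} (hh : 1 ≤ h) : ConvexPolygonWithHoles h where
  outer := triangle !₂[-(4 * (31000 * h : ℝ)), -(2 * (31000 * h : ℝ))]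
    !₂[4 * (31000 * h : ℝ), -(2 * (31000 * h : ℝ))] !₂[0, 4 * (31000 * h : ℝ)]
  hole i := triangle (leftEnd h i) (rightEnd h i) (backEnd h i)
  outer_polygon := isConvexPolygon_triangle (by
    have : (1 : ℝ) ≤ h := by exact_mod_cast hh
    simp only [cross, PiLp.sub_apply, Matrix.cons_val_zero, Matrix.cons_val_one]
    nlinarith)
  hole_polygon i := (isTriangleChain hh).isConvexPolygon i
  hole_subset i x hx := by
    have h1 : (1 : ℝ) ≤ h := by exact_mod_cast hh
    refine ball_subset_interior_triangle (by positivity) ?_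
    have hC := isTriangleChain hh
    exact ((hC.norm_lt hx).le.trans (hC.norm_left_strictMono.monotone i.2)).trans
      (norm_leftEnd_le hh)
  hole_disjoint i j hij := (isTriangleChain hh).disjoint (Fin.val_ne_of_ne hij)

theorem zero_mem_carrier {h : ℕ} (hh : 1 ≤ h) : (0 : Plane) ∈ (spiralZigzag hh).carrier := by
  have h1 : (1 : ℝ) ≤ h := by exact_mod_cast hh
  refine ⟨interior_subset (ball_subset_interior_triangle (by positivity) (by simp)),
    fun hU => ?_⟩
  obtain ⟨i, hi⟩ := Set.mem_iUnion.1 hU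
  have hC := isTriangleChain hh
  have := hC.norm_left_le (interior_subset hi)
  rw [norm_zero] at this
  exact hC.left_ne_zero i (norm_le_zero_iff.1 this)

theorem diam_spiralZigzag_le {h : ℕ} (hh : 1 ≤ h) : (spiralZigzag hh).diam₂ ≤ 310000 * h := by
  have h1 : (1 : ℝ) ≤ h := by exact_mod_cast hh
  have hsub : (spiralZigzag hh).carrier ⊆ Metric.closedBall 0 (5 * (31000 * h)) :=
    Set.sdiff_subset.trans (triangle_subset_closedBall (by positivity))
  refine (Metric.diam_mono hsub Metric.isBounded_closedBall).trans ?_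
  refine (Metric.diam_closedBall (by positivity)).trans (by linarith)

theorem le_pathLength_spiralZigzag {h : ℕ} (hh : 1 ≤ h) {u : Plane} (hu : ‖u‖ = 1)
    {l : List Plane} (hl : IsGreedyPath (spiralZigzag hh) 0 u l) :
    1 / 1000000 * √(h : ℝ) * (spiralZigzag hh).diam₂ ≤ pathLength l := by
  have h1 : (1 : ℝ) ≤ h := by exact_mod_cast hh
  have hC := isTriangleChain hh
  have hd := mul_le_mul_of_nonneg_left (diam_spiralZigzag_le hh)
    (show 0 ≤ 1 / 1000000 * √(h : ℝ) by positivity)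
  refine hd.trans ?_
  have hr : 0 ≤ √(h : ℝ) := Real.sqrt_nonneg _
  rcases lt_or_ge h 10 with hlt | hge
  -- With fewer than ten holes `√h ≤ 4`, and the distance `31000 * h` to the outer boundary is
  -- enough.
  · obtain ⟨q, hq, hle⟩ := IsGreedyFrom.exists_exit hl
    have hfar : 31000 * (h : ℝ) ≤ dist 0 q := by
      by_contra! hlt
      rw [dist_zero_left] at hlt
      exact hq.2 (ball_subset_interior_triangle (by positivity) hlt.le)
    have h10 : (h : ℝ) ≤ 10 := by exact_mod_cast hlt.le
    have h4 : √(h : ℝ) ≤ 4 := Real.sqrt_le_iff.2 ⟨by norm_num, by linarith⟩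
    nlinarith
  · have hu0 : u ≠ 0 := by
      rintro rfl
      simp at hu
    have hout : ∀ x : Plane, ‖x‖ ≤ ‖leftEnd h h‖ → x ∈ interior (spiralZigzag hh).outer :=
      fun x hx => ball_subset_interior_triangle (by positivity) (hx.trans (norm_leftEnd_le hh))
    obtain ⟨k, hk, hk1, hk2⟩ := exists_direction h hu0
    obtain ⟨i, hi, l', hl', hle⟩ := hC.exists_first_right (P := spiralZigzag hh) (fun _ => rfl) hout
      (by omega : k < h) hk1 hk2 hl
    -- All crossings into the zigzag triangles count, `h - 5 ≥ h / 2` of them, against a diameter of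
    -- at most `310000 * h`.
    have hmain := hC.mul_le_pathLength (P := spiralZigzag hh) (fun _ => rfl) hout hr
      (fun k hk ρ hρ => sqrt_le_dist h hk hρ) (by omega : i < h) hl'
    rw [max_eq_right (by omega)] at hmain
    have h10 : (10 : ℝ) ≤ h := by exact_mod_cast hge
    push_cast at hmain
    nlinarith [mul_nonneg hr (sub_nonneg.2 h10)]

end GreedyPath

theorem lemma2 :
    (∃ C : ℝ, 0 < C ∧ ∀ h : ℕ, 1 ≤ h → ∀ P : ConvexPolygonWithHoles h,
      ∀ s ∈ P.carrier, ∀ u : Plane, ‖u‖ = 1 →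
        (∃ γ : List Plane, IsGreedyPath P s u γ) ∧
        ∀ γ : List Plane, IsGreedyPath P s u γ →
          pathLength γ ≤ C * Real.sqrt (h : ℝ) * P.diam₂) ∧
    (∃ c : ℝ, 0 < c ∧ ∀ h : ℕ, 1 ≤ h → ∃ P : ConvexPolygonWithHoles h,
      ∃ s ∈ P.carrier, ∀ u : Plane, ‖u‖ = 1 →
        ∀ γ : List Plane, IsGreedyPath P s u γ →
          c * Real.sqrt (h : ℝ) * P.diam₂ ≤ pathLength γ) := by
  refine ⟨⟨4, by norm_num, fun h hh P s hs u hu => ⟨GreedyPath.exists_greedyPath hs ?_,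
    fun γ hγ => GreedyPath.pathLength_le hh hs hγ⟩⟩, 1 / 1000000, by norm_num, fun h hh =>
    ⟨GreedyPath.spiralZigzag hh, 0, GreedyPath.zero_mem_carrier hh, fun u hu γ hγ =>
      GreedyPath.le_pathLength_spiralZigzag hh hu hγ⟩⟩
  rintro rfl
  simp at hu
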